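/- Let $(H,\langle\cdot,\cdot\rangle,\|\cdot\|)$ be a separable complex Hilbert space and let $A:D(A)\subset H\to H$ be a strictly positive selfadjoint operator (i.e. $A$ is selfadjoint and $\langle Au,u\rangle\ge c\|u\|^2$ on $D(A)$ for some $c>0$) with spectral measure $E_A$ on its spectrum $\sigma(A)\subset(0,\infty)$. For a continuous function $\varphi$ on $\sigma(A)$ write $\varphi(A)=\int_{\sigma(A)}\varphi\,dE_A$. Let $f:\sigma(A)\to[0,\infty)$ be continuous and put $$\mathcal Z=\{s\in\sigma(A):\ f(s)=0\}.$$ Let $\mathcal H=D(A^{1/2})\times H$ with the norm $\|(u,v)\|_{\mathcal H}^2=\|A^{1/2}u\|^2+\|v\|^2$, and let $S(t)$, $t\ge 0$, be the strongly continuous semigroup on $\mathcal H$ whose infinitesimal generator is the operator $$\mathbb A(u,v)=(v,\,-Au-f(A)v),\qquad D(\mathbb A)=\{(u,v)\in\mathcal H:\ v\in D(A^{1/2}),\ Au+f(A)v\in H\},$$ where $Au+f(A)v$ is understood in the sense of duality: $Au+f(A)v=h\in H$ means $\langle Aw,u\rangle+\langle f(A)w,v\rangle=\langle w,h\rangle$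 for all $w\in D(A)\cap D(f(A))$. Thus $S(t)$ is the solution semigroup of $\ddot u+Au+f(A)\dot u=0$. Call $S(t)$ stable if $\lim_{t\to\infty}\|S(t)z\|_{\mathcal H}=0$ for every $z\in\mathcal H$. Assume that $A^{-1}$ is a compact operator on $H$. If $S(t)$ is stable, then $\mathcal Z=\emptyset$. Consequently, in this case, $S(t)$ is stable if and only if $\mathcal Z=\emptyset$. -/

import Mathlib

open MeasureTheory Filter Topology
open scoped ENNReal NNReal ComplexConjugate

noncomputable section

namespace DampedWave

/-! ### Integrals against complex measures -/

/-- The integral of a complex function against a complex measure. -/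
def cintegral (μ : ComplexMeasure ℝ) (φ : ℝ → ℂ) : ℂ :=
  VectorMeasure.integral μ φ (ContinuousLinearMap.mul ℝ ℂ)

theorem cintegral_add {μ ν : ComplexMeasure ℝ} {φ : ℝ → ℂ}
    (hμ : μ.Integrable φ) (hν : ν.Integrable φ) :
    cintegral (μ + ν) φ = cintegral μ φ + cintegral ν φ :=
  VectorMeasure.integral_add_vectorMeasure hμ hν

theorem integrable_smul {μ : ComplexMeasure ℝ} {φ : ℝ → ℂ} (hμ : μ.Integrable φ) (c : ℂ) :
    VectorMeasure.Integrable (c • μ) φ := by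
  apply Integrable.mono_measure (Integrable.smul_measure_nnreal hμ (c := ‖c‖₊))
  simp [VectorMeasure.variation_smul]

theorem cintegral_smul {μ : ComplexMeasure ℝ} {φ : ℝ → ℂ} (hμ : μ.Integrable φ) (c : ℂ) :
    cintegral (c • μ) φ = c * cintegral μ φ := by
  have hle : (c • μ).variation ≤ ((‖c‖₊ : ℝ≥0∞)) • μ.variation := by
    simp [VectorMeasure.variation_smul]
  have hT : DominatedFinMeasAdditive μ.variation
      ((c • μ).transpose (ContinuousLinearMap.mul ℝ ℂ))
      (‖c‖ * ‖ContinuousLinearMap.mul ℝ ℂ‖) := by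
    refine ⟨fun s t hs ht _ _ hd => cbmApplyMeasure_union (c • μ)
      (ContinuousLinearMap.mul ℝ ℂ) hs ht hd, fun s hs hsf => ?_⟩
    refine (norm_cbmApplyMeasure_le (c • μ) (ContinuousLinearMap.mul ℝ ℂ) s).trans ?_
    have h1 := VectorMeasure.norm_measure_le_variation hsf.ne
    have h2 : ‖(c • μ) s‖ = ‖c‖ * ‖μ s‖ := by simp
    rw [h2, mul_comm ‖c‖ ‖ContinuousLinearMap.mul ℝ ℂ‖, mul_assoc]
    gcongr
  have h0 : cintegral (c • μ) φ = setToFun μ.variation _ hT φ :=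
    (setToFun_congr_measure_of_integrable _ ENNReal.coe_ne_top hle hT _ φ hμ).symm
  rw [h0]
  unfold cintegral VectorMeasure.integral
  refine Integrable.induction
    (P := fun φ => setToFun μ.variation _ hT φ = c * setToFun μ.variation _
      (dominatedFinMeasAdditive_cbmApplyMeasure μ (ContinuousLinearMap.mul ℝ ℂ)) φ)
    ?_ ?_ ?_ ?_ hμ
  · intro x s hs hsf
    rw [setToFun_indicator_const _ hs hsf.ne, setToFun_indicator_const _ hs hsf.ne]
    change x * (c • μ) s = c * (x * μ s)
    simp
    ring
  · intro f g _ hf hg h1 h2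
    rw [setToFun_add _ hf hg, setToFun_add _ hf hg, h1, h2, mul_add]
  · exact isClosed_eq (continuous_setToFun _) ((continuous_setToFun _).const_mul _)
  · intro f g hfg _ h
    rw [← setToFun_congr_ae _ hfg, ← setToFun_congr_ae _ hfg, h]

/-! ### Spectral measures -/

section Hilbert

variable {H : Type*} [NormedAddCommGroup H] [InnerProductSpace ℂ H] [CompleteSpace H]

/-- A (projection-valued) spectral measure on the Borel sets of the real line.
The value of `proj` on sets that are not Borel is irrelevant. -/
structure SpectralMeasure (H : Type*) [NormedAddCommGroup H] [InnerProductSpace ℂ H]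
    [CompleteSpace H] where
  proj : Set ℝ → H →L[ℂ] H
  isStarProjection : ∀ s, MeasurableSet s → IsStarProjection (proj s)
  proj_empty : proj ∅ = 0
  proj_univ : proj Set.univ = 1
  proj_inter : ∀ s t, MeasurableSet s → MeasurableSet t → proj (s ∩ t) = proj s * proj t
  proj_union : ∀ s t, MeasurableSet s → MeasurableSet t → Disjoint s t →
    proj (s ∪ t) = proj s + proj t
  hasSum_inner : ∀ (u v : H) (s : ℕ → Set ℝ), (∀ n, MeasurableSet (s n)) →
    Pairwise (Function.onFun Disjoint s) →
    HasSum (fun n => inner ℂ v (proj (s n) u)) (inner ℂ v (proj (⋃ n, s n) u))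

namespace SpectralMeasure

variable (E : SpectralMeasure H)

open scoped Classical in
/-- The complex measure `μ_{u,v}(s) = ⟨E(s) u, v⟩` (Mathlib's inner product is linear in its
second argument). -/
def complexMeasure (u v : H) : ComplexMeasure ℝ where
  measureOf' s := if MeasurableSet s then inner ℂ v (E.proj s u) else 0
  empty' := by simp [E.proj_empty]
  not_measurable' s hs := by simp [hs]
  m_iUnion' s hs hd := by
    simp only [hs, if_true, MeasurableSet.iUnion hs]
    exact E.hasSum_inner u v s hs hd

theorem complexMeasure_apply (u v : H) {s : Set ℝ} (hs : MeasurableSet s) :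
    E.complexMeasure u v s = inner ℂ v (E.proj s u) := by
  classical
  exact (if_pos hs : (if MeasurableSet s then inner ℂ v (E.proj s u) else 0) = _)

theorem complexMeasure_add (u u' v : H) :
    E.complexMeasure (u + u') v = E.complexMeasure u v + E.complexMeasure u' v := by
  ext s hs : 1
  simp [complexMeasure_apply, hs]

theorem complexMeasure_smul (c : ℂ) (u v : H) :
    E.complexMeasure (c • u) v = c • E.complexMeasure u v := by
  ext s hs : 1
  simp [complexMeasure_apply, hs]

theorem complexMeasure_zero (v : H) : E.complexMeasure 0 v = 0 := by
  ext s hs : 1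
  simp [complexMeasure_apply, hs]

theorem inner_proj_self (u : H) {s : Set ℝ} (hs : MeasurableSet s) :
    inner ℂ u (E.proj s u) = ((‖E.proj s u‖ ^ 2 : ℝ) : ℂ) := by
  have h := E.isStarProjection s hs
  have hi : E.proj s (E.proj s u) = E.proj s u := by
    have := h.isIdempotentElem
    exact congrArg (fun T : H →L[ℂ] H => T u) this.eq
  have hsa : ContinuousLinearMap.adjoint (E.proj s) = E.proj s := h.isSelfAdjoint
  calc inner ℂ u (E.proj s u) = inner ℂ u (E.proj s (E.proj s u)) := by rw [hi]
    _ = inner ℂ (ContinuousLinearMap.adjoint (E.proj s) u) (E.proj s u) :=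
        (ContinuousLinearMap.adjoint_inner_left _ _ _).symm
    _ = inner ℂ (E.proj s u) (E.proj s u) := by rw [hsa]
    _ = _ := by rw [inner_self_eq_norm_sq_to_K]; norm_cast

/-- `μ_{u,u}` as a positive measure: `μ_{u,u}(s) = ⟨E(s) u, u⟩ = ‖E(s) u‖²`. -/
def diagMeasure (u : H) : Measure ℝ :=
  Measure.ofMeasurable (fun s _ => ENNReal.ofReal (‖E.proj s u‖ ^ 2))
    (by simp [E.proj_empty])
    (by
      intro s hs hd
      have h := E.hasSum_inner u u s hs hd
      simp only [E.inner_proj_self u (hs _), E.inner_proj_self u (MeasurableSet.iUnion hs)] at h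
      have h' : HasSum (fun n => ‖E.proj (s n) u‖ ^ 2) (‖E.proj (⋃ n, s n) u‖ ^ 2) := by
        exact_mod_cast h
      rw [← h'.tsum_eq, ENNReal.ofReal_tsum_of_nonneg (fun n => by positivity) h'.summable])

theorem diagMeasure_apply (u : H) {s : Set ℝ} (hs : MeasurableSet s) :
    E.diagMeasure u s = ENNReal.ofReal (‖E.proj s u‖ ^ 2) :=
  Measure.ofMeasurable_apply s hs

theorem diagMeasure_add_le (u v : H) :
    E.diagMeasure (u + v) ≤ (2 : ℝ≥0∞) • (E.diagMeasure u + E.diagMeasure v) := by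
  refine Measure.le_iff.2 fun s hs => ?_
  rw [Measure.smul_apply, Measure.add_apply, E.diagMeasure_apply _ hs, E.diagMeasure_apply _ hs,
    E.diagMeasure_apply _ hs, ← ENNReal.ofReal_add (by positivity) (by positivity), smul_eq_mul,
    show (2 : ℝ≥0∞) = ENNReal.ofReal 2 by simp, ← ENNReal.ofReal_mul (by norm_num)]
  apply ENNReal.ofReal_le_ofReal
  rw [map_add]
  have := norm_add_le (E.proj s u) (E.proj s v)
  nlinarith [sq_nonneg (‖E.proj s u‖ - ‖E.proj s v‖), norm_nonneg (E.proj s u + E.proj s v),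
    norm_nonneg (E.proj s u), norm_nonneg (E.proj s v)]

theorem diagMeasure_smul (c : ℂ) (u : H) :
    E.diagMeasure (c • u) = ENNReal.ofReal (‖c‖ ^ 2) • E.diagMeasure u := by
  ext s hs
  rw [Measure.smul_apply, E.diagMeasure_apply _ hs, E.diagMeasure_apply _ hs, map_smul, norm_smul,
    mul_pow, ENNReal.ofReal_mul (by positivity), smul_eq_mul]

theorem diagMeasure_zero : E.diagMeasure 0 = 0 := by
  ext s hs
  simp [E.diagMeasure_apply _ hs]

/-- The graph of the operator `∫ φ dE`: the pairs `(u, w)` such that `∫ |φ|² dμ_{u,u} < ∞` and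
`⟨w, v⟩ = ∫ φ dμ_{u,v}` for all `v`. (The integrability of `φ` with respect to `μ_{u,v}` is
automatic for measurable `φ`, by the Cauchy-Schwarz inequality.) -/
def opGraph (φ : ℝ → ℂ) : Submodule ℂ (H × H) where
  carrier := {p | (∫⁻ s, ‖φ s‖ₑ ^ 2 ∂(E.diagMeasure p.1)) < ∞ ∧
    ∀ v : H, (E.complexMeasure p.1 v).Integrable φ ∧
      inner ℂ v p.2 = cintegral (E.complexMeasure p.1 v) φ}
  zero_mem' := by
    refine ⟨by simp [diagMeasure_zero], fun v => ?_⟩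
    simp [complexMeasure_zero, cintegral]
  add_mem' := by
    rintro ⟨u, w⟩ ⟨u', w'⟩ ⟨h1, h2⟩ ⟨h1', h2'⟩
    refine ⟨?_, fun v => ?_⟩
    · refine (lintegral_mono' (E.diagMeasure_add_le u u') le_rfl).trans_lt ?_
      rw [lintegral_smul_measure, lintegral_add_measure]
      exact ENNReal.mul_lt_top (by simp) (ENNReal.add_lt_top.2 ⟨h1, h1'⟩)
    · simp only [Prod.mk_add_mk, complexMeasure_add, inner_add_right]
      refine ⟨(h2 v).1.add_vectorMeasure (h2' v).1, ?_⟩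
      rw [cintegral_add (h2 v).1 (h2' v).1, ← (h2 v).2, ← (h2' v).2]
  smul_mem' := by
    rintro c ⟨u, w⟩ ⟨h1, h2⟩
    refine ⟨?_, fun v => ?_⟩
    · simp only [Prod.smul_mk, diagMeasure_smul]
      rw [lintegral_smul_measure]
      exact ENNReal.mul_lt_top (by simp) h1
    · simp only [Prod.smul_mk, complexMeasure_smul, inner_smul_right]
      refine ⟨integrable_smul (h2 v).1 c, ?_⟩
      rw [cintegral_smul (h2 v).1, ← (h2 v).2]

/-- The operator `∫ φ dE`. -/
def op (φ : ℝ → ℂ) : H →ₗ.[ℂ] H := (E.opGraph φ).toLinearPMap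

/-- `opGraph` is single-valued, hence it is the graph of `op`. -/
theorem op_graph (φ : ℝ → ℂ) : (E.op φ).graph = E.opGraph φ := by
  apply Submodule.toLinearPMap_graph_eq
  rintro ⟨u, w⟩ ⟨-, h⟩ rfl
  have := (h w).2
  simpa [complexMeasure_zero, cintegral] using this

open scoped Classical in
/-- The Dirac spectral measure at the origin. -/
def diracZero (H : Type*) [NormedAddCommGroup H] [InnerProductSpace ℂ H] [CompleteSpace H] :
    SpectralMeasure H where
  proj s := if (0 : ℝ) ∈ s then 1 else 0
  isStarProjection s _ := by
    split_ifs
    · exact IsStarProjection.one _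
    · exact IsStarProjection.zero _
  proj_empty := by simp
  proj_univ := by simp
  proj_inter s t _ _ := by
    by_cases h1 : (0 : ℝ) ∈ s <;> by_cases h2 : (0 : ℝ) ∈ t <;> simp [h1, h2]
  proj_union s t _ _ hd := by
    by_cases h1 : (0 : ℝ) ∈ s <;> by_cases h2 : (0 : ℝ) ∈ t <;> simp [h1, h2]
    exact (Set.disjoint_left.1 hd h1 h2).elim
  hasSum_inner u v s _ hd := by
    by_cases h : ∃ n, (0 : ℝ) ∈ s n
    · obtain ⟨n, hn⟩ := h
      have h0 : (0 : ℝ) ∈ ⋃ n, s n := Set.mem_iUnion.2 ⟨n, hn⟩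
      have key := hasSum_single (f := fun m => inner ℂ v ((if (0 : ℝ) ∈ s m then
        (1 : H →L[ℂ] H) else 0) u)) n (by
          intro m hm
          have : (0 : ℝ) ∉ s m := fun h' => Set.disjoint_left.1 (hd hm) h' hn
          simp [this])
      simpa only [h0, hn, if_true] using key
    · have h0 : (0 : ℝ) ∉ ⋃ n, s n := fun h' => h (Set.mem_iUnion.1 h')
      have h1 : ∀ n, (0 : ℝ) ∉ s n := fun n h' => h ⟨n, h'⟩
      simp [h0, h1, hasSum_zero]

end SpectralMeasure

/-! ### Unbounded operators and their functional calculus -/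

/-- `R` is the inverse of `A - z`, that is, a bounded everywhere defined two-sided inverse of
`A - z : D(A) → H`. -/
def IsResolventAt (A : H →ₗ.[ℂ] H) (z : ℂ) (R : H →L[ℂ] H) : Prop :=
  (∀ y : H, ∃ x : A.domain, (x : H) = R y ∧ A x - z • (x : H) = y) ∧
    ∀ x : A.domain, R (A x - z • (x : H)) = x

/-- The (real) spectrum of `A`. For selfadjoint `A` this is the whole spectrum. -/
def realSpectrum (A : H →ₗ.[ℂ] H) : Set ℝ :=
  {s | ¬ ∃ R : H →L[ℂ] H, IsResolventAt A (s : ℂ) R}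

/-- The inverse of `A` exists and is a compact operator on `H`. -/
def HasCompactInverse (A : H →ₗ.[ℂ] H) : Prop :=
  ∃ R : H →L[ℂ] H, IsResolventAt A 0 R ∧ IsCompactOperator R

/-- `A` is selfadjoint and `⟨A u, u⟩ ≥ c ‖u‖²` for some `c > 0`. -/
def IsStrictlyPositiveSelfAdjoint (A : H →ₗ.[ℂ] H) : Prop :=
  IsSelfAdjoint A ∧ ∃ c : ℝ, 0 < c ∧ ∀ u : A.domain,
    c * ‖(u : H)‖ ^ 2 ≤ (inner ℂ (u : H) (A u)).re

/-- `E` is a spectral measure on `σ(A)` with `⟨A u, v⟩ = ∫ s dμ_{u,v}(s)` for `u ∈ D(A)`, `v ∈ H`.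
By the spectral theorem, a selfadjoint `A` has exactly one such `E` (on Borel sets). -/
def IsSpectralMeasureOf (A : H →ₗ.[ℂ] H) (E : SpectralMeasure H) : Prop :=
  E.proj (realSpectrum A)ᶜ = 0 ∧
    ∀ (u : A.domain) (v : H),
      (E.complexMeasure (u : H) v).Integrable (fun s : ℝ => (s : ℂ)) ∧
        inner ℂ v (A u) = cintegral (E.complexMeasure (u : H) v) (fun s : ℝ => (s : ℂ))

open scoped Classical in
/-- The spectral measure `E_A` of a selfadjoint operator `A`. -/
def spectralMeasure (A : H →ₗ.[ℂ] H) : SpectralMeasure H :=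
  if h : ∃ E : SpectralMeasure H, IsSpectralMeasureOf A E then h.choose
  else SpectralMeasure.diracZero H

/-- The operator `φ(A) = ∫_{σ(A)} φ(s) dE_A(s)`. Only the values of `φ` on `σ(A)` matter. -/
def funCalc (A : H →ₗ.[ℂ] H) (φ : ℝ → ℂ) : H →ₗ.[ℂ] H :=
  (spectralMeasure A).op ((realSpectrum A).indicator φ)

/-- The square root `A^{1/2}`. -/
def sqrtOp (A : H →ₗ.[ℂ] H) : H →ₗ.[ℂ] H :=
  funCalc A (fun s => ((Real.sqrt s : ℝ) : ℂ))

/-- The damping operator `f(A)`. -/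
def dampOp (A : H →ₗ.[ℂ] H) (f : ℝ → ℝ) : H →ₗ.[ℂ] H :=
  funCalc A (fun s => (f s : ℂ))

/-! ### The phase space -/

/-- The space `H¹ = D(A^{1/2})` with the norm `‖u‖₁ = ‖A^{1/2} u‖`. -/
def H1 (A : H →ₗ.[ℂ] H) : Type _ := (sqrtOp A).domain

instance (A : H →ₗ.[ℂ] H) : AddCommGroup (H1 A) :=
  inferInstanceAs (AddCommGroup (sqrtOp A).domain)

instance (A : H →ₗ.[ℂ] H) : Module ℂ (H1 A) :=
  inferInstanceAs (Module ℂ (sqrtOp A).domain)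

/-- The inclusion of `H¹` into `H`. -/
def H1.incl (A : H →ₗ.[ℂ] H) : H1 A →ₗ[ℂ] H := (sqrtOp A).domain.subtype

/-- `A^{1/2}` as a linear map from `H¹` to `H`. -/
def H1.sqrtMap (A : H →ₗ.[ℂ] H) : H1 A →ₗ[ℂ] H := (sqrtOp A).toFun

instance (A : H →ₗ.[ℂ] H) : SeminormedAddCommGroup (H1 A) :=
  SeminormedAddCommGroup.induced (H1 A) H (H1.sqrtMap A)

instance (A : H →ₗ.[ℂ] H) : NormedSpace ℂ (H1 A) :=
  NormedSpace.induced ℂ (H1 A) H (H1.sqrtMap A)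

theorem H1.norm_def (A : H →ₗ.[ℂ] H) (u : H1 A) : ‖u‖ = ‖H1.sqrtMap A u‖ := rfl

/-- The phase space `H¹ × H` with the norm `‖(u, v)‖² = ‖A^{1/2} u‖² + ‖v‖²`. For strictly positive
selfadjoint `A` the operator `A^{1/2}` is injective, and this is a Hilbert norm. -/
abbrev PhaseSpace (A : H →ₗ.[ℂ] H) : Type _ := WithLp 2 (H1 A × H)

/-- The graph of the operator `(u, v) ↦ (v, - A u - f(A) v)` on `H¹ × H`, whose domain consists of
the `(u, v)` with `v ∈ H¹` and `A u + f(A) v ∈ H`. Here `A u + f(A) v` is understood by duality,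
as the functional `w ↦ ⟨A w, u⟩ + ⟨f(A) w, v⟩` on `D(A) ∩ D(f(A))`, and it lies in `H` if it is
`w ↦ ⟨w, h⟩` for some `h ∈ H`. -/
def waveGraph (A : H →ₗ.[ℂ] H) (f : ℝ → ℝ) : Set (PhaseSpace A × PhaseSpace A) :=
  {p | H1.incl A p.2.fst = p.1.snd ∧
    ∀ (w : A.domain) (w' : (dampOp A f).domain), (w : H) = (w' : H) →
      inner ℂ (A w) (H1.incl A p.1.fst) + inner ℂ (dampOp A f w') p.1.snd =
        inner ℂ (w : H) (-p.2.snd)}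

/-- The zero-set of `f` on the spectrum of `A`. -/
def zeroSet (A : H →ₗ.[ℂ] H) (f : ℝ → ℝ) : Set ℝ :=
  {s | s ∈ realSpectrum A ∧ f s = 0}

end Hilbert

/-! ### Strongly continuous semigroups -/

/-- A strongly continuous semigroup `(S(t))_{t ≥ 0}` of bounded linear operators. The values at
negative times are irrelevant. -/
structure C0Semigroup (X : Type*) [SeminormedAddCommGroup X] [NormedSpace ℂ X] where
  toFun : ℝ → X →L[ℂ] X
  zero : toFun 0 = ContinuousLinearMap.id ℂ X
  add : ∀ s t : ℝ, 0 ≤ s → 0 ≤ t → toFun (s + t) = (toFun s).comp (toFun t)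
  tendsto : ∀ x : X, Tendsto (fun t => toFun t x) (𝓝[>] 0) (𝓝 x)

namespace C0Semigroup

variable {X : Type*} [SeminormedAddCommGroup X] [NormedSpace ℂ X] (S : C0Semigroup X)

/-- The graph of the infinitesimal generator. -/
def generatorGraph : Set (X × X) :=
  {p | Tendsto (fun t : ℝ => ((t⁻¹ : ℝ) : ℂ) • (S.toFun t p.1 - p.1)) (𝓝[>] 0) (𝓝 p.2)}

/-- Every trajectory tends to zero in norm. -/
def IsStable : Prop := ∀ x : X, Tendsto (fun t => ‖S.toFun t x‖) atTop (𝓝 0)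

end C0Semigroup

end DampedWave

end

/-!
Since `A⁻¹` is compact, `H` has a Hilbert basis of eigenvectors `b i` of `A`, with eigenvalues
`λᵢ = lam i` that exhaust `σ(A)`, and every `φ(A)` acts as multiplication by `φ(λᵢ)`. In the
coordinates `αᵢ = ⟨b i, A^{1/2} u⟩` and `βᵢ = ⟨b i, v⟩` the wave equation therefore splits into the
damped oscillators `αᵢ' = √λᵢ βᵢ`, `βᵢ' = - √λᵢ αᵢ - f(λᵢ) βᵢ`, and `‖(u, v)‖²` is the sum of their
energies `|αᵢ|² + |βᵢ|²`. If `f(λᵢ) ≤ 0` for some `i`, the energy of that oscillator does not decay,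
and `S(t)` is not stable. If `f(λᵢ) > 0` for all `i`, each energy is nonincreasing and decays
exponentially, at a rate that depends on `i`; dominated convergence of the sum of the energies gives
stability of the trajectories starting in the domain of the generator, and density together with
contractivity extends it to the whole phase space.
-/

namespace DampedWave

/-! ### Hilbert bases of eigenvectors -/

section HilbertBasis

variable {𝕜 H ι : Type*} [RCLike 𝕜] [NormedAddCommGroup H] [InnerProductSpace 𝕜 H]

theorem countable_of_orthonormal [TopologicalSpace.SeparableSpace H] {b : ι → H}
    (hb : Orthonormal 𝕜 b) : Countable ι := by
  have hdisj : Pairwise (Function.onFun Disjoint fun i => Metric.ball (b i) (1 / 2)) := by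
    intro i j hij
    apply Metric.ball_disjoint_ball
    have hsq := norm_sub_sq (𝕜 := 𝕜) (b i) (b j)
    rw [hb.2 hij, hb.1, hb.1, map_zero] at hsq
    rw [dist_eq_norm]
    nlinarith [norm_nonneg (b i - b j)]
  exact hdisj.countable_of_isOpen_disjoint (fun _ => Metric.isOpen_ball)
    fun i => ⟨b i, Metric.mem_ball_self (by norm_num)⟩

theorem eq_of_forall_inner_basis_eq (b : HilbertBasis ι 𝕜 H) {x y : H}
    (h : ∀ i, inner 𝕜 (b i) x = inner 𝕜 (b i) y) : x = y := by
  apply b.repr.injective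
  ext i
  simpa only [b.repr_apply_apply] using h i

theorem inner_basis_self (b : HilbertBasis ι 𝕜 H) (i : ι) : inner 𝕜 (b i) (b i) = 1 :=
  inner_self_eq_one_of_norm_eq_one (b.orthonormal.1 i)

theorem inner_basis_smul_basis (b : HilbertBasis ι 𝕜 H) (d : ι → 𝕜) (i j : ι) :
    inner 𝕜 (b j) (d i • b i) = d j * inner 𝕜 (b j) (b i) := by
  rw [inner_smul_right]
  obtain rfl | hji := eq_or_ne j i
  · rfl
  · rw [b.orthonormal.2 hji, mul_zero, mul_zero]

theorem hasSum_sq_norm_inner_basis (b : HilbertBasis ι 𝕜 H) (x : H) :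
    HasSum (fun i => ‖inner 𝕜 (b i) x‖ ^ 2) (‖x‖ ^ 2) := by
  have h := RCLike.hasSum_re 𝕜 (b.hasSum_inner_mul_inner x x)
  simp only [inner_self_eq_norm_sq] at h
  refine h.congr_fun fun i => ?_
  rw [inner_mul_symm_re_eq_norm, norm_mul, norm_inner_symm x, sq]

end HilbertBasis

section CompactOperator

theorem separableSpace_of_isCompactOperator {𝕜 E F : Type*} [NontriviallyNormedField 𝕜]
    [SeminormedAddCommGroup E] [NormedSpace 𝕜 E] [NormedAddCommGroup F] [NormedSpace 𝕜 F]
    {R : E →L[𝕜] F} (hR : IsCompactOperator R) (hd : DenseRange R) :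
    TopologicalSpace.SeparableSpace F := by
  have hrange : Set.range R = ⋃ n : ℕ, R '' Metric.closedBall 0 n := by
    rw [← Set.image_iUnion, Metric.iUnion_closedBall_nat, Set.image_univ]
  have hsep : TopologicalSpace.IsSeparable (Set.range R) := by
    rw [hrange]
    exact .iUnion fun n =>
      (hR.isCompact_closure_image_closedBall n).isSeparable.mono subset_closure
  rw [← TopologicalSpace.isSeparable_univ_iff, ← hd.closure_range]
  exact hsep.closure

universe u v

variable {𝕜 : Type u} {H : Type v} [RCLike 𝕜] [NormedAddCommGroup H] [InnerProductSpace 𝕜 H]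

theorem mem_orthogonal_of_forall_inner_basis_eq_zero {U : Submodule 𝕜 H} [CompleteSpace U]
    {ι : Type*} (b : HilbertBasis ι 𝕜 U) {x : H} (h : ∀ i, inner 𝕜 (b i : H) x = 0) :
    x ∈ Uᗮ := by
  rw [← Submodule.orthogonalProjectionOnto_eq_zero_iff]
  refine eq_of_forall_inner_basis_eq b fun i => by
    rw [Submodule.inner_orthogonalProjectionOnto_eq_of_mem_left, h, inner_zero_right]

theorem exists_hilbertBasis_eigenvectors [CompleteSpace H] {R : H →L[𝕜] H}
    (hR : IsCompactOperator R) (hs : (R : H →ₗ[𝕜] H).IsSymmetric) :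
    ∃ (ι : Type max u v) (b : HilbertBasis ι 𝕜 H) (μ : ι → 𝕜), ∀ i, R (b i) = μ i • b i := by
  let G : 𝕜 → Submodule 𝕜 H := Module.End.eigenspace (R : Module.End 𝕜 H)
  have hG : ∀ {μ x}, x ∈ G μ ↔ R x = μ • x := Module.End.mem_eigenspace_iff
  have hcomplete : ∀ μ, CompleteSpace (G μ) := fun μ => by
    apply IsClosed.completeSpace_coe (hs := ?_)
    rw [show (G μ : Set H) = {x | R x = μ • x} from Set.ext fun _ => hG]
    exact isClosed_eq R.continuous (continuous_const_smul μ)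
  choose w c _ using fun μ => exists_hilbertBasis 𝕜 (G μ)
  have hortho := hs.orthogonalFamily_eigenspaces.orthonormal_sigma_orthonormal
    (v_family := fun μ => c μ) (fun μ => (c μ).orthonormal)
  refine ⟨Σ μ, w μ, HilbertBasis.mkOfOrthogonalEqBot hortho ?_, fun i => i.1, fun i => ?_⟩
  · rw [eq_bot_iff, ← R.orthogonalComplement_iSup_eigenspaces_eq_bot hR hs,
      ← Submodule.iInf_orthogonal]
    intro x hx
    exact (Submodule.mem_iInf _).2 fun μ =>
      mem_orthogonal_of_forall_inner_basis_eq_zero (c μ) fun j =>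
        hx _ (Submodule.subset_span ⟨⟨μ, j⟩, rfl⟩)
  · rw [HilbertBasis.coe_mkOfOrthogonalEqBot]
    exact hG.1 (c i.1 i.2).2

end CompactOperator

/-! ### The eigenbasis of an operator with compact inverse -/

section Resolvent

variable {H : Type*} [NormedAddCommGroup H] [InnerProductSpace ℂ H] {A : H →ₗ.[ℂ] H}

theorem isResolventAt_iff_mem_graph {z : ℂ} {R : H →L[ℂ] H} :
    IsResolventAt A z R ↔ ∀ u w, (u, w) ∈ A.graph ↔ R (w - z • u) = u := by
  constructor
  · rintro ⟨hright, hleft⟩ u w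
    constructor
    · rw [LinearPMap.mem_graph_iff]
      rintro ⟨x, rfl, rfl⟩
      exact hleft x
    · intro huw
      obtain ⟨x, hx, hAx⟩ := hright (w - z • u)
      rw [huw] at hx
      rw [hx, sub_left_inj] at hAx
      exact LinearPMap.mem_graph_iff _ |>.2 ⟨x, hx, hAx⟩
  · intro h
    refine ⟨fun y => ?_, fun x => (h _ _).1 (A.mem_graph x)⟩
    have hy : (R y, y + z • R y) ∈ A.graph := (h _ _).2 (by rw [add_sub_cancel_right])
    obtain ⟨x, hx, hAx⟩ := (LinearPMap.mem_graph_iff _).1 hy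
    exact ⟨x, hx, by rw [hAx, hx, add_sub_cancel_right]⟩

theorem IsResolventAt.mem_graph_iff {R : H →L[ℂ] H} (hR : IsResolventAt A 0 R) {u w : H} :
    (u, w) ∈ A.graph ↔ R w = u := by
  rw [isResolventAt_iff_mem_graph.1 hR, zero_smul, sub_zero]

/-- `(A - s)⁻¹ = s⁻¹ A⁻¹ (s⁻¹ - A⁻¹)⁻¹`. -/
theorem IsResolventAt.exists_of_inv_mem_resolventSet {R : H →L[ℂ] H} (hR : IsResolventAt A 0 R)
    {s : ℂ} (hs : s ≠ 0) (h : s⁻¹ ∈ resolventSet ℂ R) : ∃ Q : H →L[ℂ] H, IsResolventAt A s Q := by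
  obtain ⟨P, hP⟩ := spectrum.mem_resolventSet_iff.1 h
  set T : H →L[ℂ] H := (↑P⁻¹ : H →L[ℂ] H)
  have hPx (x : H) : (P : H →L[ℂ] H) x = s⁻¹ • x - R x := by
    rw [hP, Algebra.algebraMap_eq_smul_one]
    rfl
  have hPT (y : H) : s⁻¹ • T y - R (T y) = y :=
    (hPx _).symm.trans (congrArg (fun F : H →L[ℂ] H => F y) P.mul_inv)
  have hTP (y : H) : T (s⁻¹ • y - R y) = y := by
    rw [← hPx]
    exact congrArg (fun F : H →L[ℂ] H => F y) P.inv_mul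
  have hcomm (y : H) : T (R y) = R (T y) := by
    rw [← hTP (R (T y)), ← map_smul, ← map_sub, hPT]
  refine ⟨s⁻¹ • (R * T), isResolventAt_iff_mem_graph.2 fun u w => ?_⟩
  rw [hR.mem_graph_iff]
  change _ ↔ s⁻¹ • R (T (w - s • u)) = u
  rw [← hcomm]
  constructor
  · rintro rfl
    rw [map_sub R, map_smul R, ← map_smul T, smul_sub, inv_smul_smul₀ hs, hTP]
  · intro hu
    have hu' := hPT (R (w - s • u))
    rw [(inv_smul_eq_iff₀ hs).1 hu, inv_smul_smul₀ hs, map_sub, map_smul, sub_left_inj] at hu'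
    exact hu'.symm

theorem exists_mem_graph_of_mem_realSpectrum [CompleteSpace H] {R : H →L[ℂ] H}
    (hR : IsResolventAt A 0 R) (hc : IsCompactOperator R) {s : ℝ} (hs : s ∈ realSpectrum A) :
    ∃ v : H, v ≠ 0 ∧ (v, (s : ℂ) • v) ∈ A.graph := by
  have hs0 : (s : ℂ) ≠ 0 := fun h0 => hs ⟨R, by rwa [h0]⟩
  rcases hc.hasEigenvalue_or_mem_resolventSet (inv_ne_zero hs0) with heig | hres
  · obtain ⟨v, hv, hv0⟩ := heig.exists_hasEigenvector
    have hRv : R v = (s : ℂ)⁻¹ • v := Module.End.mem_eigenspace_iff.1 hv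
    exact ⟨v, hv0, hR.mem_graph_iff.2 (by rw [map_smul, hRv, smul_inv_smul₀ hs0])⟩
  · exact absurd (hR.exists_of_inv_mem_resolventSet hs0 hres) hs

theorem mem_realSpectrum_of_mem_graph {s : ℝ} {v : H} (hv0 : v ≠ 0)
    (hv : (v, (s : ℂ) • v) ∈ A.graph) : s ∈ realSpectrum A := by
  rintro ⟨Q, hQ⟩
  have h := (isResolventAt_iff_mem_graph.1 hQ _ _).1 hv
  rw [sub_self, map_zero] at h
  exact hv0 h.symm

end Resolvent

section Eigenbasis

universe u

variable {H : Type u} [NormedAddCommGroup H] [InnerProductSpace ℂ H] [CompleteSpace H]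
  {A : H →ₗ.[ℂ] H}

theorem inner_eq_inner_of_mem_graph (hA : IsSelfAdjoint A) {u w u' w' : H}
    (h : (u, w) ∈ A.graph) (h' : (u', w') ∈ A.graph) : inner ℂ w u' = inner ℂ u w' := by
  obtain ⟨x, rfl, rfl⟩ := (LinearPMap.mem_graph_iff _).1 h
  obtain ⟨x', rfl, rfl⟩ := (LinearPMap.mem_graph_iff _).1 h'
  have hadj := LinearPMap.adjoint_isFormalAdjoint hA.dense_domain
  rw [LinearPMap.isSelfAdjoint_def.1 hA] at hadj
  exact hadj x x'

theorem IsResolventAt.isSymmetric {R : H →L[ℂ] H} (hR : IsResolventAt A 0 R)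
    (hA : IsSelfAdjoint A) : (R : H →ₗ[ℂ] H).IsSymmetric := fun _ _ =>
  (inner_eq_inner_of_mem_graph hA (hR.mem_graph_iff.2 rfl) (hR.mem_graph_iff.2 rfl)).symm

theorem IsResolventAt.denseRange {R : H →L[ℂ] H} (hR : IsResolventAt A 0 R)
    (hA : IsSelfAdjoint A) : DenseRange R := by
  refine hA.dense_domain.mono fun x hx => ?_
  obtain ⟨y, hy⟩ := LinearPMap.mem_domain_iff.1 hx
  exact ⟨y, hR.mem_graph_iff.1 hy⟩

/-- `b` is a Hilbert basis of eigenvectors of `A`, whose eigenvalues `lam` are bounded below by a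
positive constant and exhaust the spectrum. -/
structure IsEigenbasis (A : H →ₗ.[ℂ] H) {ι : Type*} (b : HilbertBasis ι ℂ H) (lam : ι → ℝ) :
    Prop where
  mem_graph : ∀ i, (b i, (lam i : ℂ) • b i) ∈ A.graph
  inner_apply : ∀ (i) (u : A.domain), inner ℂ (b i) (A u) = lam i * inner ℂ (b i) (u : H)
  exists_le : ∃ c, 0 < c ∧ ∀ i, c ≤ lam i
  realSpectrum_eq : realSpectrum A = Set.range lam

omit [CompleteSpace H] in
theorem IsEigenbasis.pos {ι : Type*} {b : HilbertBasis ι ℂ H} {lam : ι → ℝ}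
    (hb : IsEigenbasis A b lam) (i : ι) : 0 < lam i := by
  obtain ⟨c, hc, h⟩ := hb.exists_le
  exact hc.trans_le (h i)

theorem exists_hilbertBasis_mem_graph {R : H →L[ℂ] H} (hR : IsResolventAt A 0 R)
    (hc : IsCompactOperator R) (hA : IsSelfAdjoint A) :
    ∃ (ι : Type u) (b : HilbertBasis ι ℂ H) (lam : ι → ℝ),
      ∀ i, (b i, (lam i : ℂ) • b i) ∈ A.graph := by
  obtain ⟨ι, b, μ, hμ⟩ := exists_hilbertBasis_eigenvectors hc (hR.isSymmetric hA)
  refine ⟨ι, b, fun i => (μ i).re⁻¹, fun i => hR.mem_graph_iff.2 ?_⟩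
  have hre : ((μ i).re : ℂ) = μ i := by
    have h := hR.isSymmetric hA (b i) (b i)
    simp only [ContinuousLinearMap.coe_coe, hμ, inner_smul_left, inner_smul_right,
      inner_basis_self, mul_one] at h
    exact Complex.conj_eq_iff_re.1 h
  have hμ0 : μ i ≠ 0 := fun h0 => b.orthonormal.ne_zero i <| by
    have h := A.graph_fst_eq_zero_snd (hR.mem_graph_iff (w := b i).2 rfl)
    rw [hμ, h0, zero_smul] at h
    exact h rfl
  rw [map_smul, hμ, Complex.ofReal_inv, hre, inv_smul_smul₀ hμ0]

theorem isEigenbasis_of_mem_graph {R : H →L[ℂ] H} (hR : IsResolventAt A 0 R)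
    (hc : IsCompactOperator R) (hA : IsStrictlyPositiveSelfAdjoint A) {ι : Type*}
    {b : HilbertBasis ι ℂ H} {lam : ι → ℝ} (hb : ∀ i, (b i, (lam i : ℂ) • b i) ∈ A.graph) :
    IsEigenbasis A b lam := by
  obtain ⟨hsa, c, hc0, hpos⟩ := hA
  have inner_graph {u w : H} (h : (u, w) ∈ A.graph) (i : ι) :
      inner ℂ (b i) w = lam i * inner ℂ (b i) u := by
    rw [← inner_eq_inner_of_mem_graph hsa (hb i) h, inner_smul_left, Complex.conj_ofReal]
  refine ⟨hb, fun i u => inner_graph (A.mem_graph u) i, ⟨c, hc0, fun i => ?_⟩, ?_⟩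
  · obtain ⟨x, hx, hAx⟩ := (LinearPMap.mem_graph_iff _).1 (hb i)
    have h := hpos x
    rw [hAx, hx, b.orthonormal.1 i, inner_smul_right, inner_basis_self] at h
    simpa using h
  · refine Set.Subset.antisymm (fun s hs => ?_) ?_
    · obtain ⟨v, hv0, hv⟩ := exists_mem_graph_of_mem_realSpectrum hR hc hs
      by_contra hne
      refine hv0 (eq_of_forall_inner_basis_eq b fun i => ?_)
      have hsi : (s : ℂ) ≠ lam i := fun h => hne ⟨i, (Complex.ofReal_injective h).symm⟩
      have hi := inner_graph hv i
      rw [inner_smul_right, mul_eq_mul_right_iff] at hi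
      rw [hi.resolve_left hsi, inner_zero_right]
    · rintro _ ⟨i, rfl⟩
      exact mem_realSpectrum_of_mem_graph (b.orthonormal.ne_zero i) (hb i)

theorem exists_isEigenbasis (hA : IsStrictlyPositiveSelfAdjoint A) (hcomp : HasCompactInverse A) :
    ∃ (ι : Type u) (b : HilbertBasis ι ℂ H) (lam : ι → ℝ), Countable ι ∧ IsEigenbasis A b lam := by
  obtain ⟨R, hR, hc⟩ := hcomp
  obtain ⟨ι, b, lam, hb⟩ := exists_hilbertBasis_mem_graph hR hc hA.1
  have := separableSpace_of_isCompactOperator hc (hR.denseRange hA.1)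
  exact ⟨ι, b, lam, countable_of_orthonormal b.orthonormal, isEigenbasis_of_mem_graph hR hc hA hb⟩

end Eigenbasis

/-! ### Integrals against purely atomic complex measures -/

section AtomicMeasure

variable {ι : Type*}

/-- The measure `∑ |c i| δ_{lam i}`, which dominates the variation of the complex measure
`∑ c i δ_{lam i}`. -/
noncomputable def atomicMeasure (c : ι → ℂ) (lam : ι → ℝ) : Measure ℝ :=
  Measure.sum fun i => ‖c i‖ₑ • Measure.dirac (lam i)

variable {c : ι → ℂ} {lam : ι → ℝ}

theorem atomicMeasure_apply {s : Set ℝ} (hs : MeasurableSet s) :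
    atomicMeasure c lam s = ∑' i, ‖s.indicator 1 (lam i) * c i‖ₑ := by
  rw [atomicMeasure, Measure.sum_apply _ hs]
  refine tsum_congr fun i => ?_
  by_cases h : lam i ∈ s <;> simp [h, Measure.dirac_apply]

theorem lintegral_atomicMeasure (g : ℝ → ℝ≥0∞) :
    ∫⁻ s, g s ∂(atomicMeasure c lam) = ∑' i, ‖c i‖ₑ * g (lam i) := by
  simp [atomicMeasure, lintegral_sum_measure, lintegral_smul_measure]

theorem integrable_atomicMeasure [Countable ι] {φ : ℝ → ℂ} :
    Integrable φ (atomicMeasure c lam) ↔ Summable fun i => c i * φ (lam i) := by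
  rw [atomicMeasure, integrable_sum_dirac_iff fun i => enorm_ne_top]
  simp only [toReal_enorm, ← norm_mul, summable_norm_iff]

theorem mul_eq_mul_of_ae_eq_atomicMeasure {φ ψ : ℝ → ℂ} (h : φ =ᵐ[atomicMeasure c lam] ψ) (i : ι) :
    c i * φ (lam i) = c i * ψ (lam i) := by
  rw [mul_eq_mul_left_iff, or_iff_not_imp_right]
  intro hi
  have hdirac : φ =ᵐ[‖c i‖ₑ • Measure.dirac (lam i)] ψ := ae_mono (Measure.le_sum _ i) h
  rwa [EventuallyEq, Measure.ae_ennreal_smul_measure_iff (enorm_ne_zero.2 hi), ae_dirac_eq]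
    at hdirac

theorem continuous_tsum_atomicMeasure [Countable ι] :
    Continuous fun φ : Lp ℂ 1 (atomicMeasure c lam) => ∑' i, c i * φ (lam i) := by
  apply LipschitzWith.continuous (K := 1)
  intro φ ψ
  have hφ := integrable_atomicMeasure.1 (L1.integrable_coeFn φ)
  have hψ := integrable_atomicMeasure.1 (L1.integrable_coeFn ψ)
  rw [L1.edist_def, lintegral_atomicMeasure, ENNReal.coe_one, one_mul, edist_eq_enorm_sub,
    ← hφ.tsum_sub hψ]
  refine enorm_tsum_le_tsum_enorm.trans (le_of_eq (tsum_congr fun i => ?_))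
  rw [← mul_sub, enorm_mul, edist_eq_enorm_sub]

variable {μ : ComplexMeasure ℝ}

theorem variation_le_atomicMeasure
    (hμ : ∀ s, MeasurableSet s → HasSum (fun i => s.indicator 1 (lam i) * c i) (μ s)) :
    μ.variation ≤ atomicMeasure c lam :=
  VectorMeasure.variation_le_of_forall_enorm_le fun s hs => by
    rw [← (hμ s hs).tsum_eq, atomicMeasure_apply hs]
    exact enorm_tsum_le_tsum_enorm

theorem integrable_of_hasSum [Countable ι]
    (hμ : ∀ s, MeasurableSet s → HasSum (fun i => s.indicator 1 (lam i) * c i) (μ s))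
    {φ : ℝ → ℂ} (hφ : Summable fun i => c i * φ (lam i)) : μ.Integrable φ :=
  (integrable_atomicMeasure.2 hφ).mono_measure (variation_le_atomicMeasure hμ)

theorem cintegral_eq_tsum [Countable ι]
    (hμ : ∀ s, MeasurableSet s → HasSum (fun i => s.indicator 1 (lam i) * c i) (μ s))
    {φ : ℝ → ℂ} (hφ : Summable fun i => c i * φ (lam i)) :
    cintegral μ φ = ∑' i, c i * φ (lam i) := by
  have hle := variation_le_atomicMeasure hμ
  have hT := (dominatedFinMeasAdditive_cbmApplyMeasure μ
    (ContinuousLinearMap.mul ℝ ℂ)).of_measure_le hle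
    (ContinuousLinearMap.opNorm_nonneg _)
  have hsetToFun : cintegral μ φ = setToFun (atomicMeasure c lam) _ hT φ :=
    (setToFun_congr_measure_of_integrable 1 ENNReal.one_ne_top (by rwa [one_smul])
      hT _ φ (integrable_atomicMeasure.2 hφ)).symm
  rw [hsetToFun]
  refine Integrable.induction (P := fun φ => setToFun _ _ hT φ = ∑' i, c i * φ (lam i))
    ?_ ?_ ?_ ?_ (integrable_atomicMeasure.2 hφ)
  · intro x s hs hsfin
    rw [setToFun_indicator_const _ hs hsfin.ne]
    change x * μ s = _
    rw [← (hμ s hs).tsum_eq, ← tsum_mul_left]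
    refine tsum_congr fun i => ?_
    by_cases h : lam i ∈ s <;> simp [h, mul_comm]
  · intro φ ψ _ hφ hψ ihφ ihψ
    rw [setToFun_add _ hφ hψ, ihφ, ihψ, ← (integrable_atomicMeasure.1 hφ).tsum_add
      (integrable_atomicMeasure.1 hψ)]
    simp only [Pi.add_apply, mul_add]
  · exact isClosed_eq (continuous_setToFun _) continuous_tsum_atomicMeasure
  · intro φ ψ hφψ _ ih
    rw [← setToFun_congr_ae _ hφψ, ih]
    exact tsum_congr (mul_eq_mul_of_ae_eq_atomicMeasure hφψ)

end AtomicMeasure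

/-! ### Spectral measures in an eigenbasis -/

section SpectralMeasure

variable {H : Type*} [NormedAddCommGroup H] [InnerProductSpace ℂ H]
  {ι : Type*} {b : HilbertBasis ι ℂ H} {lam : ι → ℝ}

theorem continuousLinearMap_ext_basis (b : HilbertBasis ι ℂ H) {P Q : H →L[ℂ] H}
    (h : ∀ i, P (b i) = Q (b i)) : P = Q := by
  refine ContinuousLinearMap.ext_on (s := Set.range b) ?_ (Set.forall_mem_range.2 h)
  rw [dense_iff_closure_eq, ← Submodule.topologicalClosure_coe, b.dense_span, Submodule.top_coe]

theorem hasSum_inner_of_apply_basis {P : H →L[ℂ] H} {d : ι → ℂ}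
    (hP : ∀ i, P (b i) = d i • b i) (u v : H) :
    HasSum (fun i => d i * (inner ℂ v (b i) * inner ℂ (b i) u)) (inner ℂ v (P u)) := by
  refine (((b.hasSum_repr u).mapL P).mapL (innerSL ℂ v)).congr_fun fun i => ?_
  rw [map_smul, hP, innerSL_apply_apply, inner_smul_right, inner_smul_right, b.repr_apply_apply]
  ring

variable [CompleteSpace H]

/-- The orthogonal projection onto the closed span of the basis vectors `b i` with `lam i ∈ s`. -/
noncomputable def spectralProj (b : HilbertBasis ι ℂ H) (lam : ι → ℝ) (s : Set ℝ) : H →L[ℂ] H :=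
  haveI : CompleteSpace (Submodule.span ℂ (b '' (lam ⁻¹' s))).topologicalClosure :=
    (Submodule.isClosed_topologicalClosure _).completeSpace_coe
  (Submodule.span ℂ (b '' (lam ⁻¹' s))).topologicalClosure.starProjection

theorem isStarProjection_spectralProj (s : Set ℝ) : IsStarProjection (spectralProj b lam s) :=
  isStarProjection_starProjection

theorem spectralProj_basis (s : Set ℝ) (i : ι) :
    spectralProj b lam s (b i) = s.indicator (1 : ℝ → ℂ) (lam i) • b i := by
  rw [spectralProj]
  by_cases h : lam i ∈ s
  · rw [Set.indicator_of_mem h, Pi.one_apply, one_smul, Submodule.starProjection_eq_self_iff]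
    exact Submodule.le_topologicalClosure _ (Submodule.subset_span ⟨i, h, rfl⟩)
  · rw [Set.indicator_of_notMem h, zero_smul, Submodule.starProjection_apply_eq_zero_iff,
      Submodule.orthogonal_closure]
    refine (Submodule.isOrtho_span.2 ?_).symm (Submodule.mem_span_singleton_self (b i))
    rintro _ ⟨j, hj, rfl⟩ _ rfl
    refine b.orthonormal.2 ?_
    rintro rfl
    exact h hj

theorem hasSum_inner_spectralProj_iUnion {s : ℕ → Set ℝ}
    (hs : Pairwise (Function.onFun Disjoint s)) (u v : H) :
    HasSum (fun n => inner ℂ v (spectralProj b lam (s n) u))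
      (inner ℂ v (spectralProj b lam (⋃ n, s n) u)) := by
  have hasSum_subtype (t : Set ℝ) : HasSum
      (fun i : lam ⁻¹' t => inner ℂ v (b i) * inner ℂ (b i) u)
      (inner ℂ v (spectralProj b lam t u)) := by
    refine (hasSum_subtype_iff_indicator (f := fun i => inner ℂ v (b i) * inner ℂ (b i) u)).2
      ((hasSum_inner_of_apply_basis (spectralProj_basis t) u v).congr_fun fun i => ?_)
    by_cases h : lam i ∈ t <;> simp [Set.indicator, h]
  have hdisj : Pairwise (Function.onFun Disjoint fun n => lam ⁻¹' s n) :=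
    fun m n hmn => (hs hmn).preimage lam
  have hunion := hasSum_subtype (⋃ n, s n)
  rw [Set.preimage_iUnion, ← (Set.unionEqSigmaOfDisjoint hdisj).symm.hasSum_iff] at hunion
  exact hunion.sigma fun n => hasSum_subtype (s n)

/-- The spectral measure concentrated on the values `lam i`, with `b i` in the range of the
projection of `{lam i}`. -/
noncomputable def basisSpectralMeasure (b : HilbertBasis ι ℂ H) (lam : ι → ℝ) :
    SpectralMeasure H where
  proj := spectralProj b lam
  isStarProjection s _ := isStarProjection_spectralProj s
  proj_empty := continuousLinearMap_ext_basis b fun i => by simp [spectralProj_basis]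
  proj_univ := continuousLinearMap_ext_basis b fun i => by simp [spectralProj_basis]
  proj_inter s t _ _ := continuousLinearMap_ext_basis b fun i => by
    simp [spectralProj_basis, Set.inter_indicator_one, smul_smul, mul_comm]
  proj_union s t _ _ hd := continuousLinearMap_ext_basis b fun i => by
    simp [spectralProj_basis, Set.indicator_union_of_disjoint hd, add_smul]
  hasSum_inner u v _ _ hd := hasSum_inner_spectralProj_iUnion hd u v

namespace SpectralMeasure

variable (E : SpectralMeasure H)

theorem proj_inter_apply {s t : Set ℝ} (hs : MeasurableSet s) (ht : MeasurableSet t) (x : H) :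
    E.proj (s ∩ t) x = E.proj s (E.proj t x) := by
  rw [E.proj_inter s t hs ht]
  rfl

theorem proj_add_proj_compl_apply {s : Set ℝ} (hs : MeasurableSet s) (x : H) :
    E.proj s x + E.proj sᶜ x = x := by
  rw [← add_apply, ← E.proj_union s sᶜ hs hs.compl disjoint_compl_right, Set.union_compl_self,
    E.proj_univ]
  rfl

theorem inner_proj_left {s : Set ℝ} (hs : MeasurableSet s) (x y : H) :
    inner ℂ (E.proj s x) y = inner ℂ x (E.proj s y) :=
  (E.isStarProjection s hs).isSelfAdjoint.isSymmetric x y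

theorem diagMeasure_eq_zero_iff {s : Set ℝ} (hs : MeasurableSet s) {x : H} :
    E.diagMeasure x s = 0 ↔ E.proj s x = 0 := by
  rw [E.diagMeasure_apply x hs, ENNReal.ofReal_eq_zero, sq_nonpos_iff, norm_eq_zero]

theorem complexMeasure_proj_singleton (u v : H) (s : ℝ) :
    E.complexMeasure u (E.proj {s} v) = VectorMeasure.dirac s (inner ℂ v (E.proj {s} u)) := by
  classical
  ext t ht : 1
  rw [E.complexMeasure_apply u _ ht, E.inner_proj_left (measurableSet_singleton s),
    ← E.proj_inter_apply (measurableSet_singleton s) ht]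
  by_cases hst : s ∈ t
  · rw [Set.inter_eq_self_of_subset_left (Set.singleton_subset_iff.2 hst),
      VectorMeasure.dirac_apply_of_mem ht hst]
  · rw [Set.singleton_inter_eq_empty.2 hst, E.proj_empty,
      VectorMeasure.dirac_apply_of_notMem hst, zero_apply, inner_zero_right]

theorem proj_singleton_apply_of_inner_eq_cintegral {φ : ℝ → ℂ} {u w : H}
    (h : ∀ v, inner ℂ v w = cintegral (E.complexMeasure u v) φ) (s : ℝ) :
    E.proj {s} w = φ s • E.proj {s} u := by
  refine ext_inner_left ℂ fun v => ?_
  rw [← E.inner_proj_left (measurableSet_singleton s), h, E.complexMeasure_proj_singleton,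
    inner_smul_right]
  exact VectorMeasure.integral_dirac

end SpectralMeasure

/-- The vectors `b i` are eigenvectors of the spectral measure `E`, with eigenvalues `lam i`. -/
def IsDiagonal (E : SpectralMeasure H) (b : HilbertBasis ι ℂ H) (lam : ι → ℝ) : Prop :=
  ∀ i, E.proj {lam i} (b i) = b i

theorem isDiagonal_basisSpectralMeasure : IsDiagonal (basisSpectralMeasure b lam) b lam :=
  fun i => (spectralProj_basis _ i).trans (by simp)

namespace IsDiagonal

variable {E : SpectralMeasure H} (hE : IsDiagonal E b lam)

include hE

theorem proj_basis {s : Set ℝ} (hs : MeasurableSet s) (i : ι) :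
    E.proj s (b i) = s.indicator (1 : ℝ → ℂ) (lam i) • b i := by
  have hinter := E.proj_inter_apply hs (measurableSet_singleton (lam i)) (b i)
  rw [hE i] at hinter
  rw [← hinter]
  by_cases h : lam i ∈ s
  · rw [Set.inter_eq_self_of_subset_right (Set.singleton_subset_iff.2 h), hE i,
      Set.indicator_of_mem h, Pi.one_apply, one_smul]
  · rw [Set.inter_singleton_eq_empty.2 h, E.proj_empty, Set.indicator_of_notMem h, zero_smul,
      zero_apply]

theorem hasSum_complexMeasure (u v : H) (s : Set ℝ) (hs : MeasurableSet s) :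
    HasSum (fun i => s.indicator 1 (lam i) * (inner ℂ v (b i) * inner ℂ (b i) u))
      (E.complexMeasure u v s) := by
  rw [E.complexMeasure_apply u v hs]
  exact hasSum_inner_of_apply_basis (hE.proj_basis hs) u v

theorem diagMeasure_eq_atomicMeasure (u : H) :
    E.diagMeasure u = atomicMeasure (fun i => inner ℂ u (b i) * inner ℂ (b i) u) lam := by
  ext s hs
  have hterm (i : ι) : ‖s.indicator (1 : ℝ → ℂ) (lam i) * (inner ℂ u (b i) * inner ℂ (b i) u)‖ =
      ‖inner ℂ (b i) (E.proj s u)‖ ^ 2 := by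
    rw [← E.inner_proj_left hs, hE.proj_basis hs, inner_smul_left]
    by_cases h : lam i ∈ s <;> simp [h, norm_inner_symm u, sq]
  have hsum := hasSum_sq_norm_inner_basis b (E.proj s u)
  rw [E.diagMeasure_apply u hs, atomicMeasure_apply hs, ← hsum.tsum_eq,
    ENNReal.ofReal_tsum_of_nonneg (fun _ => sq_nonneg _) hsum.summable]
  exact tsum_congr fun i => by rw [← hterm, ofReal_norm]

theorem mem_opGraph_iff [Countable ι] {φ : ℝ → ℂ} {u w : H} :
    (u, w) ∈ E.opGraph φ ↔ ∀ i, inner ℂ (b i) w = φ (lam i) * inner ℂ (b i) u := by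
  constructor
  · rintro ⟨-, h⟩ i
    have hproj := E.proj_singleton_apply_of_inner_eq_cintegral (fun v => (h v).2) (lam i)
    rw [← hE i, E.inner_proj_left (measurableSet_singleton _), hproj, inner_smul_right,
      E.inner_proj_left (measurableSet_singleton _)]
  · intro h
    have hterm (v : H) (i : ι) : inner ℂ v (b i) * inner ℂ (b i) u * φ (lam i) =
        inner ℂ v (b i) * inner ℂ (b i) w := by
      rw [h i]
      ring
    have hsummable (v : H) : Summable fun i => inner ℂ v (b i) * inner ℂ (b i) u * φ (lam i) := by
      simpa only [hterm v] using b.summable_inner_mul_inner v w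
    refine ⟨?_, fun v => ⟨integrable_of_hasSum (hE.hasSum_complexMeasure u v) (hsummable v), ?_⟩⟩
    · have henorm (i : ι) : ‖inner ℂ u (b i) * inner ℂ (b i) u‖ₑ * ‖φ (lam i)‖ₑ ^ 2 =
          ‖inner ℂ w (b i) * inner ℂ (b i) w‖ₑ := by
        rw [← inner_conj_symm w, ← inner_conj_symm u, h i]
        simp only [map_mul, enorm_mul, RCLike.enorm_conj]
        ring
      change ∫⁻ s, ‖φ s‖ₑ ^ 2 ∂(E.diagMeasure u) < ∞
      rw [hE.diagMeasure_eq_atomicMeasure, lintegral_atomicMeasure, tsum_congr henorm]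
      exact (tsum_enorm_ne_top_iff_summable_norm.2 (b.summable_inner_mul_inner w w).norm).lt_top
    · rw [cintegral_eq_tsum (hE.hasSum_complexMeasure u v) (hsummable v), tsum_congr (hterm v)]
      exact (b.tsum_inner_mul_inner v w).symm

end IsDiagonal

namespace IsEigenbasis

variable {A : H →ₗ.[ℂ] H} [Countable ι] (hb : IsEigenbasis A b lam)

include hb

theorem isSpectralMeasureOf : IsSpectralMeasureOf A (basisSpectralMeasure b lam) := by
  refine ⟨continuousLinearMap_ext_basis b fun i => ?_, fun u v => ?_⟩
  · refine (spectralProj_basis _ i).trans ?_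
    simp [hb.realSpectrum_eq]
  · have hmem : ((u : H), A u) ∈ (basisSpectralMeasure b lam).opGraph fun s : ℝ => (s : ℂ) :=
      isDiagonal_basisSpectralMeasure.mem_opGraph_iff.2 fun i => hb.inner_apply i u
    exact hmem.2 v

omit [Countable ι] in
theorem proj_singleton_eq_zero {E : SpectralMeasure H} (hE : IsSpectralMeasureOf A E) {i : ι}
    {s : ℝ} (hs : s ≠ lam i) : E.proj {s} (b i) = 0 := by
  obtain ⟨x, hx, hAx⟩ := (LinearPMap.mem_graph_iff _).1 (hb.mem_graph i)
  have hproj := E.proj_singleton_apply_of_inner_eq_cintegral (fun v => (hE.2 x v).2) s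
  rw [hx, hAx, map_smul, ← sub_eq_zero, ← sub_smul] at hproj
  exact (smul_eq_zero.1 hproj).resolve_left (sub_ne_zero.2 (mod_cast hs.symm))

theorem isDiagonal {E : SpectralMeasure H} (hE : IsSpectralMeasureOf A E) :
    IsDiagonal E b lam := by
  intro i
  have hrange : MeasurableSet (Set.range lam) := (Set.countable_range lam).measurableSet
  have hcover : ({lam i}ᶜ : Set ℝ) ⊆ (Set.range lam)ᶜ ∪ ⋃ s ∈ Set.range lam \ {lam i}, {s} := by
    intro s hs
    by_cases h : s ∈ Set.range lam
    · exact Or.inr (Set.mem_biUnion ⟨h, hs⟩ rfl)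
    · exact Or.inl h
  have hnull : E.diagMeasure (b i) {lam i}ᶜ = 0 := by
    refine measure_mono_null hcover (measure_union_null ?_ ?_)
    · rw [E.diagMeasure_eq_zero_iff hrange.compl, ← hb.realSpectrum_eq, hE.1, zero_apply]
    · refine (measure_biUnion_null_iff ((Set.countable_range lam).mono Set.sdiff_subset)).2 ?_
      rintro s ⟨-, hs⟩
      exact (E.diagMeasure_eq_zero_iff (measurableSet_singleton s)).2
        (hb.proj_singleton_eq_zero hE hs)
  have hadd := E.proj_add_proj_compl_apply (measurableSet_singleton (lam i)) (b i)
  rwa [(E.diagMeasure_eq_zero_iff (measurableSet_singleton _).compl).1 hnull, add_zero] at hadd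

theorem isDiagonal_spectralMeasure : IsDiagonal (spectralMeasure A) b lam := by
  have hex : ∃ E : SpectralMeasure H, IsSpectralMeasureOf A E := ⟨_, hb.isSpectralMeasureOf⟩
  rw [spectralMeasure, dif_pos hex]
  exact hb.isDiagonal hex.choose_spec

theorem mem_funCalc_graph_iff {φ : ℝ → ℂ} {u w : H} :
    (u, w) ∈ (funCalc A φ).graph ↔ ∀ i, inner ℂ (b i) w = φ (lam i) * inner ℂ (b i) u := by
  have hmem (i : ι) : lam i ∈ realSpectrum A := hb.realSpectrum_eq ▸ Set.mem_range_self i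
  rw [funCalc, SpectralMeasure.op_graph, hb.isDiagonal_spectralMeasure.mem_opGraph_iff]
  simp only [Set.indicator_of_mem (hmem _)]

end IsEigenbasis

end SpectralMeasure

/-! ### Strongly continuous semigroups -/

namespace C0Semigroup

variable {X : Type*} [SeminormedAddCommGroup X] [NormedSpace ℂ X] (S : C0Semigroup X)

theorem zero_apply (x : X) : S.toFun 0 x = x := by
  rw [S.zero]
  rfl

theorem add_apply {s t : ℝ} (hs : 0 ≤ s) (ht : 0 ≤ t) (x : X) :
    S.toFun (s + t) x = S.toFun s (S.toFun t x) := by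
  rw [S.add s t hs ht]
  rfl

theorem toFun_toFun_comm {s t : ℝ} (hs : 0 ≤ s) (ht : 0 ≤ t) (x : X) :
    S.toFun s (S.toFun t x) = S.toFun t (S.toFun s x) := by
  rw [← S.add_apply hs ht, ← S.add_apply ht hs, add_comm]

theorem tendsto_nhdsGE (x : X) : Tendsto (fun t => S.toFun t x) (𝓝[≥] 0) (𝓝 x) := by
  rw [← Set.Ioi_insert, nhdsWithin_insert, tendsto_sup]
  refine ⟨?_, S.tendsto x⟩
  simpa only [S.zero_apply] using tendsto_pure_nhds (fun t => S.toFun t x) 0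

theorem exists_norm_le_near_zero [CompleteSpace X] :
    ∃ δ > 0, ∃ C, ∀ t ∈ Set.Icc 0 δ, ‖S.toFun t‖ ≤ C := by
  by_contra! h
  choose t ht hlarge using fun n : ℕ => h (1 / ((n : ℝ) + 1)) (by positivity) n
  have hlim : Tendsto t atTop (𝓝[≥] 0) :=
    tendsto_nhdsWithin_iff.2 ⟨squeeze_zero (fun n => (ht n).1) (fun n => (ht n).2)
      tendsto_one_div_add_atTop_nhds_zero_nat, Eventually.of_forall fun n => (ht n).1⟩
  obtain ⟨C, hC⟩ := banach_steinhaus (g := fun n => S.toFun (t n)) fun x => by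
    obtain ⟨C, hC⟩ := ((S.tendsto_nhdsGE x).comp hlim).norm.bddAbove_range
    exact ⟨C, fun n => hC ⟨n, rfl⟩⟩
  obtain ⟨n, hn⟩ := exists_nat_gt C
  exact absurd ((hlarge n).trans_le (hC n)) hn.not_gt

theorem norm_toFun_add_le {s t : ℝ} (hs : 0 ≤ s) (ht : 0 ≤ t) :
    ‖S.toFun (s + t)‖ ≤ ‖S.toFun s‖ * ‖S.toFun t‖ := by
  rw [S.add s t hs ht]
  exact ContinuousLinearMap.opNorm_comp_le _ _

theorem exists_norm_le [CompleteSpace X] (T : ℝ) :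
    ∃ C, ∀ t ∈ Set.Icc 0 T, ‖S.toFun t‖ ≤ C := by
  obtain ⟨δ, hδ, C, hC⟩ := S.exists_norm_le_near_zero
  have hpow (n : ℕ) (s : ℝ) (hs : s ∈ Set.Icc 0 δ) :
      ‖S.toFun (n * s)‖ ≤ ‖S.toFun 0‖ * C ^ n := by
    induction n with
    | zero => simp
    | succ n ih =>
      rw [Nat.cast_succ, add_one_mul, pow_succ, ← mul_assoc]
      exact (S.norm_toFun_add_le (mul_nonneg n.cast_nonneg hs.1) hs.1).trans
        (mul_le_mul ih (hC s hs) (norm_nonneg _) ((norm_nonneg _).trans ih))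
  obtain ⟨n, hn⟩ := exists_nat_gt (max (T / δ) 0)
  obtain ⟨hTn, hn0⟩ := max_lt_iff.1 hn
  refine ⟨‖S.toFun 0‖ * C ^ n, fun t ht => ?_⟩
  have hquot : t / n ∈ Set.Icc 0 δ :=
    ⟨div_nonneg ht.1 hn0.le, (div_le_iff₀' hn0).2 (ht.2.trans ((div_lt_iff₀ hδ).1 hTn).le)⟩
  rw [← mul_div_cancel₀ t hn0.ne']
  exact hpow n (t / n) hquot

theorem norm_apply_sub_apply_le {s t : ℝ} (hs : 0 ≤ s) (ht : 0 ≤ t) (x : X) :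
    ‖S.toFun t x - S.toFun s x‖ ≤ ‖S.toFun (min s t)‖ * ‖S.toFun |t - s| x - x‖ := by
  wlog hst : s ≤ t generalizing s t
  · rw [norm_sub_rev, min_comm, abs_sub_comm]
    exact this ht hs (le_of_not_ge hst)
  have hadd : S.toFun t x = S.toFun s (S.toFun (t - s) x) := by
    rw [← S.add_apply hs (sub_nonneg.2 hst), add_sub_cancel]
  rw [min_eq_left hst, abs_of_nonneg (sub_nonneg.2 hst), hadd, ← map_sub]
  exact (S.toFun s).le_opNorm _

theorem continuousOn [CompleteSpace X] (x : X) :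
    ContinuousOn (fun t => S.toFun t x) (Set.Ici 0) := by
  intro s hs
  obtain ⟨C, hC⟩ := S.exists_norm_le s
  have habs : Tendsto (fun t => |t - s|) (𝓝[Set.Ici 0] s) (𝓝[≥] 0) := by
    have hcont : Tendsto (fun t => |t - s|) (𝓝 s) (𝓝 0) :=
      Continuous.tendsto' (by fun_prop) s 0 (by simp)
    exact tendsto_nhdsWithin_iff.2
      ⟨hcont.mono_left nhdsWithin_le_nhds,
        Eventually.of_forall fun t => Set.mem_Ici.2 (abs_nonneg _)⟩
  have hlim : Tendsto (fun t => C * ‖S.toFun |t - s| x - x‖) (𝓝[Set.Ici 0] s) (𝓝 0) := by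
    simpa only [mul_zero, Function.comp_apply] using
      (tendsto_iff_norm_sub_tendsto_zero.1 ((S.tendsto_nhdsGE x).comp habs)).const_mul C
  refine tendsto_iff_norm_sub_tendsto_zero.2
    (squeeze_zero' (Eventually.of_forall fun t => norm_nonneg _) ?_ hlim)
  filter_upwards [self_mem_nhdsWithin] with t ht
  refine (S.norm_apply_sub_apply_le hs ht x).trans ?_
  gcongr
  exact hC _ ⟨le_min hs ht, min_le_left s t⟩

/-- The domain of the infinitesimal generator. -/
def domain : Submodule ℂ X where
  carrier := {x | ∃ y, (x, y) ∈ S.generatorGraph}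
  zero_mem' := ⟨0, by simp [generatorGraph, tendsto_const_nhds]⟩
  add_mem' := by
    rintro x x' ⟨y, h⟩ ⟨y', h'⟩
    refine ⟨y + y', (h.add h').congr fun t => ?_⟩
    simp only [map_add, ← smul_add, add_sub_add_comm]
  smul_mem' := by
    rintro c x ⟨y, h⟩
    refine ⟨c • y, (h.const_smul c).congr fun t => ?_⟩
    simp only [map_smul, ← smul_sub, smul_comm c]

theorem apply_mem_generatorGraph {x y : X} (h : (x, y) ∈ S.generatorGraph) {t : ℝ} (ht : 0 ≤ t) :
    (S.toFun t x, S.toFun t y) ∈ S.generatorGraph := by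
  refine (((S.toFun t).continuous.tendsto y).comp h).congr' ?_
  filter_upwards [self_mem_nhdsWithin] with r hr
  simp only [Function.comp_apply, map_smul, map_sub, S.toFun_toFun_comm ht (le_of_lt hr)]

theorem hasDerivWithinAt_comp_apply {K : Type*} [NormedAddCommGroup K] [NormedSpace ℂ K]
    (Φ : X →L[ℂ] K) {x y : X} (h : (x, y) ∈ S.generatorGraph) {t : ℝ} (ht : 0 ≤ t) :
    HasDerivWithinAt (fun r => Φ (S.toFun r x)) (Φ (S.toFun t y)) (Set.Ici t) t := by
  rw [← hasDerivWithinAt_Ioi_iff_Ici, hasDerivWithinAt_iff_tendsto_slope' Set.self_notMem_Ioi]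
  have hshift : Tendsto (fun r => r - t) (𝓝[>] t) (𝓝[>] 0) := by
    have hcont : Tendsto (fun r => r - t) (𝓝 t) (𝓝 0) :=
      Continuous.tendsto' (by fun_prop) t 0 (sub_self t)
    refine tendsto_nhdsWithin_iff.2 ⟨hcont.mono_left nhdsWithin_le_nhds, ?_⟩
    filter_upwards [self_mem_nhdsWithin] with r hr using Set.mem_Ioi.2 (sub_pos.2 hr)
  refine (((Φ.continuous.tendsto _).comp (S.apply_mem_generatorGraph h ht)).comp hshift).congr' ?_
  filter_upwards [self_mem_nhdsWithin] with r hr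
  have hadd : S.toFun r x = S.toFun (r - t) (S.toFun t x) := by
    rw [← S.add_apply (sub_nonneg.2 (le_of_lt hr)) ht, sub_add_cancel]
  rw [Function.comp_apply, Function.comp_apply, slope_def_module, hadd, map_smul, map_sub,
    Complex.coe_smul]

theorem isStable_of_dense {D : Set X} (hD : Dense D)
    (hle : ∀ x ∈ D, ∀ t, 0 ≤ t → ‖S.toFun t x‖ ≤ ‖x‖)
    (hlim : ∀ x ∈ D, Tendsto (fun t => ‖S.toFun t x‖) atTop (𝓝 0)) : S.IsStable := by
  intro x
  have hcontr (t : ℝ) (ht : 0 ≤ t) (z : X) : ‖S.toFun t z‖ ≤ ‖z‖ :=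
    closure_minimal (fun z hz => hle z hz t ht)
      (isClosed_le (S.toFun t).continuous.norm continuous_norm) (hD z)
  rw [Metric.tendsto_nhds]
  intro ε hε
  obtain ⟨y, hy, hxy⟩ := hD.exists_dist_lt x (half_pos hε)
  filter_upwards [eventually_ge_atTop 0, (hlim y hy).eventually_lt_const (half_pos hε)]
    with t ht hyt
  rw [dist_zero_right, norm_norm]
  calc ‖S.toFun t x‖ = ‖S.toFun t (x - y) + S.toFun t y‖ := by rw [map_sub, sub_add_cancel]
    _ ≤ ‖x - y‖ + ‖S.toFun t y‖ := (norm_add_le _ _).trans (by gcongr; exact hcontr t ht _)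
    _ < ε / 2 + ε / 2 := add_lt_add (by rwa [← dist_eq_norm]) hyt
    _ = ε := add_halves ε

end C0Semigroup

/-! ### The damped oscillator -/

section Oscillator

theorem le_mul_exp_of_right_deriv_le {F F' : ℝ → ℝ} {K : ℝ} (hF : ContinuousOn F (Set.Ici 0))
    (hF' : ∀ t, 0 ≤ t → HasDerivWithinAt F (F' t) (Set.Ici t) t)
    (hle : ∀ t, 0 ≤ t → F' t ≤ K * F t) {t : ℝ} (ht : 0 ≤ t) : F t ≤ F 0 * Real.exp (K * t) := by
  have hgronwall := le_gronwallBound_of_liminf_deriv_right_le (f := F) (f' := F') (δ := F 0)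
    (K := K) (ε := 0) (hF.mono Set.Icc_subset_Ici_self)
    (fun s hs r hr => (hF' s hs.1).liminf_right_slope_le hr) le_rfl
    (fun s hs => by simpa only [add_zero] using hle s hs.1) t ⟨ht, le_rfl⟩
  rwa [gronwallBound_ε0, sub_zero] at hgronwall

variable {V : Type*} [NormedAddCommGroup V] [InnerProductSpace ℝ V]

theorem two_mul_abs_inner_le (x y : V) : 2 * |inner ℝ x y| ≤ ‖x‖ ^ 2 + ‖y‖ ^ 2 := by
  nlinarith [abs_real_inner_le_norm x y, sq_nonneg (‖x‖ - ‖y‖)]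

/-- The curve `(α, β)` solves the damped oscillator `α' = ω β`, `β' = - ω α - g β` for `t ≥ 0`.
Only right derivatives are required, as these are what the generator of a semigroup provides. -/
structure IsDampedOscillator (ω g : ℝ) (α β : ℝ → V) : Prop where
  continuousOn_fst : ContinuousOn α (Set.Ici 0)
  continuousOn_snd : ContinuousOn β (Set.Ici 0)
  hasDerivWithinAt_fst : ∀ t, 0 ≤ t → HasDerivWithinAt α (ω • β t) (Set.Ici t) t
  hasDerivWithinAt_snd : ∀ t, 0 ≤ t →
    HasDerivWithinAt β (-(ω • α t) - g • β t) (Set.Ici t) t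

namespace IsDampedOscillator

variable {ω g : ℝ} {α β : ℝ → V} (h : IsDampedOscillator ω g α β)

include h

theorem continuousOn_energy : ContinuousOn (fun t => ‖α t‖ ^ 2 + ‖β t‖ ^ 2) (Set.Ici 0) :=
  (h.continuousOn_fst.norm.pow 2).add (h.continuousOn_snd.norm.pow 2)

theorem hasDerivWithinAt_energy {t : ℝ} (ht : 0 ≤ t) :
    HasDerivWithinAt (fun t => ‖α t‖ ^ 2 + ‖β t‖ ^ 2) (-(2 * g * ‖β t‖ ^ 2)) (Set.Ici t) t := by
  refine ((h.hasDerivWithinAt_fst t ht).norm_sq.add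
    (h.hasDerivWithinAt_snd t ht).norm_sq).congr_deriv ?_
  rw [inner_sub_right, inner_neg_right, real_inner_smul_right, real_inner_smul_right,
    real_inner_smul_right, real_inner_comm, real_inner_self_eq_norm_sq]
  ring

theorem energy_le (hg : 0 ≤ g) {t : ℝ} (ht : 0 ≤ t) :
    ‖α t‖ ^ 2 + ‖β t‖ ^ 2 ≤ ‖α 0‖ ^ 2 + ‖β 0‖ ^ 2 := by
  have hle := le_mul_exp_of_right_deriv_le (K := 0) h.continuousOn_energy
    (fun s hs => h.hasDerivWithinAt_energy hs)
    (fun s _ => by rw [zero_mul, neg_nonpos]; positivity) ht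
  rwa [zero_mul, Real.exp_zero, mul_one] at hle

theorem le_energy (hg : g ≤ 0) {t : ℝ} (ht : 0 ≤ t) :
    ‖α 0‖ ^ 2 + ‖β 0‖ ^ 2 ≤ ‖α t‖ ^ 2 + ‖β t‖ ^ 2 := by
  have hle := le_mul_exp_of_right_deriv_le (K := 0) h.continuousOn_energy.neg
    (fun s hs => (h.hasDerivWithinAt_energy hs).neg)
    (fun s _ => by nlinarith [sq_nonneg ‖β s‖]) ht
  rwa [zero_mul, Real.exp_zero, mul_one, Pi.neg_apply, Pi.neg_apply, neg_le_neg_iff] at hle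

theorem continuousOn_lyapunov (ε : ℝ) : ContinuousOn
    (fun t => ‖α t‖ ^ 2 + ‖β t‖ ^ 2 + 2 * ε * inner ℝ (α t) (β t)) (Set.Ici 0) :=
  h.continuousOn_energy.add
    ((h.continuousOn_fst.inner (𝕜 := ℝ) h.continuousOn_snd).const_mul _)

theorem hasDerivWithinAt_lyapunov (ε : ℝ) {t : ℝ} (ht : 0 ≤ t) :
    HasDerivWithinAt (fun t => ‖α t‖ ^ 2 + ‖β t‖ ^ 2 + 2 * ε * inner ℝ (α t) (β t))
      (-(2 * ε * ω * ‖α t‖ ^ 2 + 2 * (g - ε * ω) * ‖β t‖ ^ 2 + 2 * ε * g * inner ℝ (α t) (β t)))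
      (Set.Ici t) t := by
  refine ((h.hasDerivWithinAt_energy ht).add (((h.hasDerivWithinAt_fst t ht).inner ℝ
    (h.hasDerivWithinAt_snd t ht)).const_mul (2 * ε))).congr_deriv ?_
  rw [inner_sub_right, inner_neg_right, real_inner_smul_right, real_inner_smul_right,
    real_inner_smul_left, real_inner_self_eq_norm_sq, real_inner_self_eq_norm_sq]
  ring

theorem exists_energy_le_mul_exp (hω : 0 < ω) (hg : 0 < g) :
    ∃ K < 0, ∃ C, ∀ t, 0 ≤ t → ‖α t‖ ^ 2 + ‖β t‖ ^ 2 ≤ C * Real.exp (K * t) := by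
  -- The choice of `ε` makes the cross term of the derivative absorbable by its diagonal terms.
  obtain ⟨ε, hε, hε2, hεg⟩ : ∃ ε, 0 < ε ∧ 2 * ε ≤ 1 ∧ ε * (3 * ω ^ 2 + g ^ 2) = g * ω := by
    refine ⟨g * ω / (3 * ω ^ 2 + g ^ 2), by positivity, ?_, div_mul_cancel₀ _ (by positivity)⟩
    rw [← mul_div_assoc, div_le_one (by positivity)]
    nlinarith [sq_nonneg (g - ω)]
  set L : ℝ → ℝ := fun t => ‖α t‖ ^ 2 + ‖β t‖ ^ 2 + 2 * ε * inner ℝ (α t) (β t)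
  have hcross (t : ℝ) : |2 * ε * inner ℝ (α t) (β t)| ≤ ε * (‖α t‖ ^ 2 + ‖β t‖ ^ 2) := by
    rw [mul_comm 2, mul_assoc, abs_mul, abs_mul, abs_two, abs_of_pos hε]
    gcongr
    exact two_mul_abs_inner_le _ _
  have hlower (t : ℝ) : ‖α t‖ ^ 2 + ‖β t‖ ^ 2 ≤ 2 * L t := by
    nlinarith [(abs_le.1 (hcross t)).1, sq_nonneg ‖α t‖, sq_nonneg ‖β t‖]
  have hupper (t : ℝ) : L t ≤ 2 * (‖α t‖ ^ 2 + ‖β t‖ ^ 2) := by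
    nlinarith [(abs_le.1 (hcross t)).2, sq_nonneg ‖α t‖, sq_nonneg ‖β t‖]
  have hdecay {t : ℝ} (ht : 0 ≤ t) : L t ≤ L 0 * Real.exp (-(ε * ω / 2) * t) := by
    refine le_mul_exp_of_right_deriv_le (h.continuousOn_lyapunov ε)
      (fun s hs => h.hasDerivWithinAt_lyapunov ε hs) (fun s _ => ?_) ht
    have hyoung : -(2 * (g * ω) * inner ℝ (α s) (β s)) ≤ ω ^ 2 * ‖α s‖ ^ 2 + g ^ 2 * ‖β s‖ ^ 2 := by
      have hcross' := two_mul_abs_inner_le (ω • α s) (g • β s)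
      rw [real_inner_smul_left, real_inner_smul_right, norm_smul_of_nonneg hω.le,
        norm_smul_of_nonneg hg.le] at hcross'
      linarith [neg_abs_le (ω * (g * inner ℝ (α s) (β s)))]
    have henergy : -(2 * ε * ω * ‖α s‖ ^ 2 + 2 * (g - ε * ω) * ‖β s‖ ^ 2 +
        2 * ε * g * inner ℝ (α s) (β s)) ≤ -(ε * ω) * (‖α s‖ ^ 2 + ‖β s‖ ^ 2) := by
      refine le_of_mul_le_mul_right ?_ hω
      linear_combination ε * hyoung + 2 * ‖β s‖ ^ 2 * hεg +
        ε * (3 * ω ^ 2 + g ^ 2) * sq_nonneg ‖β s‖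
    refine henergy.trans ?_
    linear_combination (ε * ω / 2) * hupper s
  refine ⟨-(ε * ω / 2), by linarith [mul_pos hε hω], 2 * L 0, fun t ht => ?_⟩
  rw [mul_assoc]
  exact (hlower t).trans (by gcongr; exact hdecay ht)

theorem tendsto_energy (hω : 0 < ω) (hg : 0 < g) :
    Tendsto (fun t => ‖α t‖ ^ 2 + ‖β t‖ ^ 2) atTop (𝓝 0) := by
  obtain ⟨K, hK, C, hC⟩ := h.exists_energy_le_mul_exp hω hg
  have hexp : Tendsto (fun t => C * Real.exp (K * t)) atTop (𝓝 0) := by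
    simpa only [mul_zero, Function.comp_def, id_eq] using (Real.tendsto_exp_atBot.comp
      (tendsto_id.const_mul_atTop_of_neg hK)).const_mul C
  refine squeeze_zero' (Eventually.of_forall fun t => by positivity) ?_ hexp
  filter_upwards [eventually_ge_atTop 0] with t ht using hC t ht

end IsDampedOscillator

end Oscillator

/-! ### The phase space in an eigenbasis -/

section PhaseSpace

variable {H : Type*} [NormedAddCommGroup H] [InnerProductSpace ℂ H] [CompleteSpace H]
  {ι : Type*} {b : HilbertBasis ι ℂ H} {lam : ι → ℝ} {A : H →ₗ.[ℂ] H}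

namespace H1

theorem mem_graph (u : H1 A) : (incl A u, sqrtMap A u) ∈ (sqrtOp A).graph :=
  (sqrtOp A).mem_graph u

theorem exists_of_mem_graph {u w : H} (h : (u, w) ∈ (sqrtOp A).graph) :
    ∃ x : H1 A, incl A x = u ∧ sqrtMap A x = w :=
  (LinearPMap.mem_graph_iff _).1 h

variable (A) in
/-- The square root `A^{1/2}` as a linear isometry of `H¹` into `H`; the norm of `H¹` is induced
by it. -/
noncomputable def sqrtIsometry : H1 A →ₗᵢ[ℂ] H where
  toLinearMap := sqrtMap A
  norm_map' _ := rfl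

end H1

/-- The coordinate `(u, v) ↦ ⟨x, A^{1/2} u⟩` on the phase space. Over a Hilbert basis of vectors `x`
the squares of these coordinates sum up to the potential energy `‖A^{1/2} u‖²`. -/
noncomputable def potentialCoord (A : H →ₗ.[ℂ] H) (x : H) : PhaseSpace A →L[ℂ] ℂ :=
  innerSL ℂ x ∘L (H1.sqrtIsometry A).toContinuousLinearMap ∘L WithLp.fstL 2 ℂ (H1 A) H

/-- The coordinate `(u, v) ↦ ⟨x, v⟩` on the phase space. Over a Hilbert basis of vectors `x` the
squares of these coordinates sum up to the kinetic energy `‖v‖²`. -/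
noncomputable def kineticCoord (A : H →ₗ.[ℂ] H) (x : H) : PhaseSpace A →L[ℂ] ℂ :=
  innerSL ℂ x ∘L WithLp.sndL 2 ℂ (H1 A) H

theorem hasSum_sq_norm_coord (b : HilbertBasis ι ℂ H) (z : PhaseSpace A) :
    HasSum (fun i => ‖potentialCoord A (b i) z‖ ^ 2 + ‖kineticCoord A (b i) z‖ ^ 2) (‖z‖ ^ 2) := by
  rw [WithLp.prod_norm_sq_eq_of_L2]
  exact (hasSum_sq_norm_inner_basis b (H1.sqrtMap A z.fst)).add (hasSum_sq_norm_inner_basis b z.snd)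

namespace IsEigenbasis

variable [Countable ι] (hb : IsEigenbasis A b lam)

include hb

theorem inner_sqrtMap (i : ι) (u : H1 A) :
    inner ℂ (b i) (H1.sqrtMap A u) = (√(lam i) : ℝ) * inner ℂ (b i) (H1.incl A u) :=
  hb.mem_funCalc_graph_iff.1 (H1.mem_graph u) i

theorem basis_mem_funCalc_graph (φ : ℝ → ℂ) (i : ι) :
    (b i, φ (lam i) • b i) ∈ (funCalc A φ).graph :=
  hb.mem_funCalc_graph_iff.2 (inner_basis_smul_basis b (fun j => φ (lam j)) i)

theorem sqrtMap_surjective : Function.Surjective (H1.sqrtMap A) := by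
  intro w
  obtain ⟨c, hc, hle⟩ := hb.exists_le
  have hmem : Memℓp (fun i => ((√(lam i) : ℝ) : ℂ)⁻¹ * inner ℂ (b i) w) 2 := by
    refine ((lp.memℓp (b.repr w)).const_mul ((√c : ℝ) : ℂ)⁻¹).mono' fun i => ?_
    rw [norm_mul, norm_mul, norm_inv, norm_inv, Complex.norm_of_nonneg (Real.sqrt_nonneg _),
      Complex.norm_of_nonneg (Real.sqrt_nonneg _), b.repr_apply_apply]
    gcongr
    exact hle i
  obtain ⟨u, -, hu⟩ := H1.exists_of_mem_graph (A := A) (u := b.repr.symm ⟨_, hmem⟩) (w := w) <| by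
    refine hb.mem_funCalc_graph_iff.2 fun i => ?_
    have hne : ((√(lam i) : ℝ) : ℂ) ≠ 0 :=
      Complex.ofReal_ne_zero.2 (Real.sqrt_pos.2 (hb.pos i)).ne'
    rw [← b.repr_apply_apply (b.repr.symm _), LinearIsometryEquiv.apply_symm_apply]
    exact (mul_inv_cancel_left₀ hne _).symm
  exact ⟨u, hu⟩

theorem completeSpace_phaseSpace : CompleteSpace (PhaseSpace A) := by
  have : CompleteSpace (H1 A) :=
    ((H1.sqrtIsometry A).isometry.isUniformInducing.completeSpace_congr
      hb.sqrtMap_surjective).2 inferInstance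
  infer_instance

theorem exists_incl_eq_basis (i : ι) :
    ∃ e : H1 A, H1.incl A e = b i ∧ H1.sqrtMap A e = ((√(lam i) : ℝ) : ℂ) • b i :=
  H1.exists_of_mem_graph (hb.basis_mem_funCalc_graph _ i)

theorem mem_waveGraph_iff {f : ℝ → ℝ} {z z' : PhaseSpace A} :
    (z, z') ∈ waveGraph A f ↔ H1.incl A z'.fst = z.snd ∧ ∀ i, inner ℂ (b i) z'.snd =
      -(lam i * inner ℂ (b i) (H1.incl A z.fst)) - f (lam i) * inner ℂ (b i) z.snd := by
  have hA (w : A.domain) (i : ι) : inner ℂ (A w) (b i) = lam i * inner ℂ (w : H) (b i) := by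
    rw [← inner_conj_symm, hb.inner_apply, map_mul, inner_conj_symm, Complex.conj_ofReal]
  have hf (w : (dampOp A f).domain) (i : ι) :
      inner ℂ (dampOp A f w) (b i) = f (lam i) * inner ℂ (w : H) (b i) := by
    rw [← inner_conj_symm, hb.mem_funCalc_graph_iff.1 ((dampOp A f).mem_graph w) i, map_mul,
      inner_conj_symm, Complex.conj_ofReal]
  refine and_congr_right fun _ => ⟨fun h i => ?_, fun h w w' hw => ?_⟩
  · obtain ⟨w, hw, hAw⟩ := (LinearPMap.mem_graph_iff _).1 (hb.mem_graph i)
    obtain ⟨w', hw', hfw⟩ := (LinearPMap.mem_graph_iff (dampOp A f)).1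
      (hb.basis_mem_funCalc_graph _ i)
    have htest := h w w' (hw.trans hw'.symm)
    rw [hAw, hfw, hw, inner_smul_left, inner_smul_left, Complex.conj_ofReal,
      Complex.conj_ofReal, inner_neg_right] at htest
    linear_combination htest
  · have hsum := (b.hasSum_inner_mul_inner (A w) (H1.incl A z.fst)).add
      (b.hasSum_inner_mul_inner (dampOp A f w') z.snd)
    refine hsum.unique ((b.hasSum_inner_mul_inner (w : H) (-z'.snd)).congr_fun fun i => ?_)
    rw [hA, hf, ← hw, inner_neg_right, h i]
    ring

theorem dense_of_basis_mem {D : Submodule ℂ (PhaseSpace A)}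
    (hfst : ∀ (i) (e : H1 A), H1.incl A e = b i → WithLp.toLp 2 (e, 0) ∈ D)
    (hsnd : ∀ i, WithLp.toLp 2 (0, b i) ∈ D) : Dense (D : Set (PhaseSpace A)) := by
  have hspan {K : Submodule ℂ H} (hK : ∀ i, b i ∈ K) : Dense (K : Set H) := by
    rw [Submodule.dense_iff_topologicalClosure_eq_top, ← top_le_iff, ← b.dense_span]
    exact Submodule.topologicalClosure_mono (Submodule.span_le.2 (Set.range_subset_iff.2 hK))
  let U : Submodule ℂ (H1 A) := D.comap
    ((WithLp.linearEquiv 2 ℂ (H1 A × H)).symm.toLinearMap ∘ₗ LinearMap.inl ℂ (H1 A) H)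
  let V : Submodule ℂ H := D.comap
    ((WithLp.linearEquiv 2 ℂ (H1 A × H)).symm.toLinearMap ∘ₗ LinearMap.inr ℂ (H1 A) H)
  have hV : Dense (V : Set H) := hspan hsnd
  have himage : Dense (U.map (H1.sqrtMap A) : Set H) := hspan fun i => by
    obtain ⟨e, he, hsqrt⟩ := hb.exists_incl_eq_basis i
    have hne : ((√(lam i) : ℝ) : ℂ) ≠ 0 :=
      Complex.ofReal_ne_zero.2 (Real.sqrt_pos.2 (hb.pos i)).ne'
    rw [← Submodule.smul_mem_iff _ hne, ← hsqrt]
    exact Submodule.mem_map_of_mem (hfst i e he)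
  have hU : Dense (U : Set (H1 A)) := fun u => by
    rw [(H1.sqrtIsometry A).isometry.isUniformInducing.isInducing.closure_eq_preimage_closure_image]
    exact himage _
  have hprod := (WithLp.toLp_surjective 2).denseRange.dense_image
    (WithLp.prod_continuous_toLp 2 (H1 A) H) (hU.prod hV)
  refine hprod.mono ?_
  rintro _ ⟨⟨u, v⟩, ⟨hu, hv⟩, rfl⟩
  have hadd : WithLp.toLp 2 (u, v) = WithLp.toLp 2 (u, 0) + WithLp.toLp 2 (0, v) := by
    rw [← WithLp.toLp_add, Prod.mk_add_mk, add_zero, zero_add]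
  exact hadd ▸ D.add_mem hu hv

end IsEigenbasis

end PhaseSpace

/-! ### Stability -/

section Stability

variable {H : Type*} [NormedAddCommGroup H] [InnerProductSpace ℂ H] [CompleteSpace H]
  {ι : Type*} [Countable ι] {b : HilbertBasis ι ℂ H} {lam : ι → ℝ} {A : H →ₗ.[ℂ] H}
  {f : ℝ → ℝ} {S : C0Semigroup (PhaseSpace A)}

namespace IsEigenbasis

variable (hb : IsEigenbasis A b lam) (hS : S.generatorGraph = waveGraph A f)

include hb

theorem potentialCoord_of_mem_waveGraph {z z' : PhaseSpace A} (h : (z, z') ∈ waveGraph A f)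
    (i : ι) : potentialCoord A (b i) z' = √(lam i) • kineticCoord A (b i) z := by
  rw [Complex.real_smul]
  refine (hb.inner_sqrtMap i z'.fst).trans ?_
  rw [(hb.mem_waveGraph_iff.1 h).1]
  rfl

theorem kineticCoord_of_mem_waveGraph {z z' : PhaseSpace A} (h : (z, z') ∈ waveGraph A f)
    (i : ι) : kineticCoord A (b i) z' =
      -(√(lam i) • potentialCoord A (b i) z) - f (lam i) • kineticCoord A (b i) z := by
  have hsqrt : (√(lam i) : ℂ) * inner ℂ (b i) (H1.sqrtMap A z.fst) =
      lam i * inner ℂ (b i) (H1.incl A z.fst) := by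
    rw [hb.inner_sqrtMap, ← mul_assoc, ← Complex.ofReal_mul, Real.mul_self_sqrt (hb.pos i).le]
  refine ((hb.mem_waveGraph_iff.1 h).2 i).trans ?_
  rw [Complex.real_smul, Complex.real_smul, ← hsqrt]
  rfl

include hS

theorem isDampedOscillator {z z' : PhaseSpace A} (hz : (z, z') ∈ S.generatorGraph) (i : ι) :
    IsDampedOscillator √(lam i) (f (lam i)) (fun t => potentialCoord A (b i) (S.toFun t z))
      (fun t => kineticCoord A (b i) (S.toFun t z)) := by
  have := hb.completeSpace_phaseSpace
  have hwave {t : ℝ} (ht : 0 ≤ t) : (S.toFun t z, S.toFun t z') ∈ waveGraph A f :=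
    hS ▸ S.apply_mem_generatorGraph hz ht
  exact {
    continuousOn_fst := (potentialCoord A (b i)).continuous.comp_continuousOn (S.continuousOn z)
    continuousOn_snd := (kineticCoord A (b i)).continuous.comp_continuousOn (S.continuousOn z)
    hasDerivWithinAt_fst := fun t ht => hb.potentialCoord_of_mem_waveGraph (hwave ht) i ▸
      S.hasDerivWithinAt_comp_apply _ hz ht
    hasDerivWithinAt_snd := fun t ht => hb.kineticCoord_of_mem_waveGraph (hwave ht) i ▸
      S.hasDerivWithinAt_comp_apply _ hz ht }

theorem toLp_basis_zero_mem_domain {i : ι} {e : H1 A} (he : H1.incl A e = b i) :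
    WithLp.toLp 2 (e, 0) ∈ S.domain := by
  refine ⟨WithLp.toLp 2 (0, -((lam i : ℂ) • b i)),
    hS ▸ hb.mem_waveGraph_iff.2 ⟨map_zero _, fun j => ?_⟩⟩
  rw [WithLp.toLp_fst, WithLp.toLp_snd, WithLp.toLp_snd, he, inner_zero_right, mul_zero, sub_zero,
    inner_neg_right, inner_basis_smul_basis b (fun j => (lam j : ℂ))]

theorem toLp_zero_basis_mem_domain (i : ι) : WithLp.toLp 2 (0, b i) ∈ S.domain := by
  obtain ⟨e, he, -⟩ := hb.exists_incl_eq_basis i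
  refine ⟨WithLp.toLp 2 (e, -((f (lam i) : ℂ) • b i)),
    hS ▸ hb.mem_waveGraph_iff.2 ⟨he, fun j => ?_⟩⟩
  rw [WithLp.toLp_fst, WithLp.toLp_snd, WithLp.toLp_snd, map_zero, inner_zero_right, mul_zero,
    neg_zero, zero_sub, inner_neg_right, inner_basis_smul_basis b (fun j => (f (lam j) : ℂ))]

theorem dense_domain : Dense (S.domain : Set (PhaseSpace A)) :=
  hb.dense_of_basis_mem (fun _ _ he => hb.toLp_basis_zero_mem_domain hS he)
    (hb.toLp_zero_basis_mem_domain hS)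

theorem tendsto_norm_of_mem_generatorGraph {z z' : PhaseSpace A} (hz : (z, z') ∈ S.generatorGraph)
    (hf : ∀ i, 0 < f (lam i)) : Tendsto (fun t => ‖S.toFun t z‖) atTop (𝓝 0) := by
  have hsq : Tendsto (fun t => ‖S.toFun t z‖ ^ 2) atTop (𝓝 0) := by
    have hlim := tendsto_tsum_of_dominated_convergence
      (hasSum_sq_norm_coord b (S.toFun 0 z)).summable
      (fun i => (hb.isDampedOscillator hS hz i).tendsto_energy (Real.sqrt_pos.2 (hb.pos i)) (hf i))
      (by
        filter_upwards [eventually_ge_atTop 0] with t ht i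
        rw [Real.norm_of_nonneg (by positivity)]
        exact (hb.isDampedOscillator hS hz i).energy_le (hf i).le ht)
    simpa only [tsum_zero, (hasSum_sq_norm_coord b _).tsum_eq] using hlim
  simpa only [Real.sqrt_sq (norm_nonneg _), Real.sqrt_zero] using hsq.sqrt

theorem norm_toFun_le_of_mem_generatorGraph {z z' : PhaseSpace A}
    (hz : (z, z') ∈ S.generatorGraph) (hf : ∀ i, 0 ≤ f (lam i)) {t : ℝ} (ht : 0 ≤ t) :
    ‖S.toFun t z‖ ≤ ‖z‖ := by
  refine pow_le_pow_iff_left₀ (norm_nonneg _) (norm_nonneg _) two_ne_zero |>.1 ?_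
  refine hasSum_le (fun i => ?_) (hasSum_sq_norm_coord b _) (hasSum_sq_norm_coord b z)
  simpa only [S.zero_apply] using (hb.isDampedOscillator hS hz i).energy_le (hf i) ht

theorem isStable (hf : ∀ i, 0 < f (lam i)) : S.IsStable :=
  S.isStable_of_dense (hb.dense_domain hS)
    (fun _ ⟨_, hz⟩ _ ht => hb.norm_toFun_le_of_mem_generatorGraph hS hz (fun i => (hf i).le) ht)
    (fun _ ⟨_, hz⟩ => hb.tendsto_norm_of_mem_generatorGraph hS hz hf)

theorem one_le_norm_toFun {i : ι} (hf : f (lam i) ≤ 0) {t : ℝ} (ht : 0 ≤ t) :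
    1 ≤ ‖S.toFun t (WithLp.toLp 2 (0, b i))‖ := by
  obtain ⟨z', hz⟩ := hb.toLp_zero_basis_mem_domain hS i
  have hinit : potentialCoord A (b i) (WithLp.toLp 2 (0, b i)) = 0 ∧
      kineticCoord A (b i) (WithLp.toLp 2 (0, b i)) = 1 :=
    ⟨by simp [potentialCoord], inner_basis_self b i⟩
  have hmode := (hb.isDampedOscillator hS hz i).le_energy hf ht
  rw [S.zero_apply, hinit.1, hinit.2, norm_zero, norm_one] at hmode
  have hcoord := le_hasSum (hasSum_sq_norm_coord b (S.toFun t (WithLp.toLp 2 (0, b i)))) i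
    fun j _ => by positivity
  refine (one_le_sq_iff₀ (norm_nonneg _)).1 (le_trans ?_ (hmode.trans hcoord))
  norm_num

theorem isStable_iff : S.IsStable ↔ ∀ i, 0 < f (lam i) := by
  refine ⟨fun hstable i => ?_, hb.isStable hS⟩
  by_contra! hf
  have hle : (1 : ℝ) ≤ 0 := ge_of_tendsto (hstable (WithLp.toLp 2 (0, b i))) <| by
    filter_upwards [eventually_ge_atTop 0] with t ht using hb.one_le_norm_toFun hS hf ht
  exact zero_lt_one.not_ge hle

end IsEigenbasis

end Stability

theorem zeroSet_eq_empty_iff {H : Type*} [NormedAddCommGroup H] [InnerProductSpace ℂ H]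
    {A : H →ₗ.[ℂ] H} {f : ℝ → ℝ} (hf0 : ∀ s ∈ realSpectrum A, 0 ≤ f s) :
    zeroSet A f = ∅ ↔ ∀ s ∈ realSpectrum A, 0 < f s := by
  simp only [Set.eq_empty_iff_forall_notMem, zeroSet, Set.mem_ofPred_eq, not_and]
  exact forall₂_congr fun s hs => (hf0 s hs).lt_iff_ne'.symm

end DampedWave

theorem mainTheorem9_general {H : Type*} [NormedAddCommGroup H] [InnerProductSpace ℂ H]
    [CompleteSpace H] (A : H →ₗ.[ℂ] H) (hA : DampedWave.IsStrictlyPositiveSelfAdjoint A)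
    (f : ℝ → ℝ) (S : DampedWave.C0Semigroup (DampedWave.PhaseSpace A))
    (hS : S.generatorGraph = DampedWave.waveGraph A f)
    (hcomp : DampedWave.HasCompactInverse A) :
    S.IsStable ↔ ∀ s ∈ DampedWave.realSpectrum A, 0 < f s := by
  obtain ⟨ι, b, lam, _, hb⟩ := DampedWave.exists_isEigenbasis hA hcomp
  rw [hb.realSpectrum_eq, Set.forall_mem_range]
  exact hb.isStable_iff hS

theorem mainTheorem9 {H : Type*} [NormedAddCommGroup H] [InnerProductSpace ℂ H] [CompleteSpace H]
    [TopologicalSpace.SeparableSpace H]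
    (A : H →ₗ.[ℂ] H) (hA : DampedWave.IsStrictlyPositiveSelfAdjoint A)
    (f : ℝ → ℝ) (hf : ContinuousOn f (DampedWave.realSpectrum A))
    (hf0 : ∀ s ∈ DampedWave.realSpectrum A, 0 ≤ f s)
    (S : DampedWave.C0Semigroup (DampedWave.PhaseSpace A))
    (hS : S.generatorGraph = DampedWave.waveGraph A f)
    (hcomp : DampedWave.HasCompactInverse A) :
    S.IsStable ↔ DampedWave.zeroSet A f = ∅ := by
  rw [DampedWave.zeroSet_eq_empty_iff hf0]
  exact mainTheorem9_general A hA f S hS hcomp
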